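/- Let $g$ be the Euclidean metric on $\mathbb{R}^7$ and let $\varphi = dx_{123}+dx_{145}+dx_{167}+dx_{246}-dx_{257}-dx_{347}-dx_{356}$, where $dx_{ijk}=dx_i\wedge dx_j\wedge dx_k$. An oriented 3-plane $V\subset\mathbb{R}^7$ is called associative if $\varphi|_V=\mathrm{vol}_V$, and an oriented (immersed or embedded) 3-dimensional submanifold of $\mathbb{R}^7$ is called an associative 3-fold if all its tangent planes are associative. For $\beta\in\Lambda^2\mathbb{R}^7$ let $\beta\lrcorner\varphi\in\mathbb{R}^7$ be the vector with components $\beta^{ab}\varphi_{abc}g^{cd}$, normalised so that $g((u\wedge v)\lrcorner\varphi,w)=\varphi(u,v,w)$. Let $P$ be a compact, orientable, 2-dimensional real analytic manifold (Hausdorff, without boundary), let $\chi$ be a nowhere vanishing real analytic section of $\Lambda^2TP$, and let $\psi:P\to\mathbb{R}^7$ be a real analytic immersion. Then there exists $\epsilon>0$ such that there is a unique family $\{\psi_t:t\in(-\epsilon,\epsilon)\}$ of maps $\psi_t:P\to\mathbb{R}^7$, real analytic in the sense that $\Psi(t,p)=\psi_t(p)$ is real analytic on $(-\epsilon,\epsilon)\times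 P$, which satisfies $\psi_0=\psi$ and $$\frac{d\psi_t}{dt}=(\psi_t)_*(\chi)\lrcorner\varphi\qquad\text{for all } t\in(-\epsilon,\epsilon).$$ Moreover $\Psi:(-\epsilon,\epsilon)\times P\to\mathbb{R}^7$ is a real analytic immersion, and for a suitable orientation of $(-\epsilon,\epsilon)\times P$ it makes its image $M$ a nonsingular immersed associative 3-fold in $\mathbb{R}^7$. If $\psi$ is an embedding, then $\epsilon$ can be chosen so that, in addition, $\Psi$ is an embedding, so that $M$ is a nonsingular embedded associative 3-fold. -/

import Mathlib

open Set Topology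
open scoped Manifold ContDiff

/-- `ℝ⁷` with its Euclidean metric; the coordinates `x₁, …, x₇` are indexed by `0, …, 6`. -/
abbrev R7 : Type := EuclideanSpace ℝ (Fin 7)

/-- The constant 3-form `dx_i ∧ dx_j ∧ dx_k` on `ℝ⁷`, with `i, j, k` ranging over `0, …, 6`. -/
noncomputable def dx3 (i j k : Fin 7) : R7 [⋀^Fin 3]→ₗ[ℝ] ℝ :=
  (Matrix.detRowAlternating (n := Fin 3) (R := ℝ)).compLinearMap
    (LinearMap.pi fun a : Fin 3 => (EuclideanSpace.proj (𝕜 := ℝ) (![i, j, k] a)).toLinearMap)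

/-- The associative 3-form
`dx₁₂₃ + dx₁₄₅ + dx₁₆₇ + dx₂₄₆ - dx₂₅₇ - dx₃₄₇ - dx₃₅₆` (indices here are shifted by one). -/
noncomputable def phi : R7 [⋀^Fin 3]→ₗ[ℝ] ℝ :=
  dx3 0 1 2 + dx3 0 3 4 + dx3 0 5 6 + dx3 1 3 5 - dx3 1 4 6 - dx3 2 3 6 - dx3 2 4 5

/-- The contraction `β ↦ β^{ab} φ_{abc} g^{cd}` from `Λ²ℝ⁷` to `ℝ⁷`, normalised so that
`u ∧ v` is sent to the vector with components `φ(u, v, e_d) = φ(e_d, u, v)`, that is, to the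
cross product `u × v`. -/
noncomputable def contractPhi : ⋀[ℝ]^2 R7 →ₗ[ℝ] R7 :=
  exteriorPower.alternatingMapLinearEquiv
    (∑ d : Fin 7, (LinearMap.toSpanSingleton ℝ R7 (EuclideanSpace.single d 1)).compAlternatingMap
      (phi.curryLeft (EuclideanSpace.single d 1)))

/-- An oriented subspace `V` of `ℝ⁷` is an associative 3-plane: it has dimension three and
`φ|_V = vol_V`. -/
def IsAssociativePlane (V : Submodule ℝ R7) (o : Orientation ℝ V (Fin 3)) : Prop :=
  ∃ h : Module.finrank ℝ V = 3,
    phi.compLinearMap V.subtype = @Orientation.volumeForm V _ _ 3 ⟨h⟩ o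

section Manifolds

variable {E : Type*} [NormedAddCommGroup E] [NormedSpace ℝ E] {H : Type*} [TopologicalSpace H]
  (I : ModelWithCorners ℝ E H) {N : Type*} [TopologicalSpace N] [ChartedSpace H N]

/-- A real analytic section of `Λ²TN`: in each chart of the atlas, the coordinate expression of
`χ`, a function with values in the fixed vector space `Λ²E`, has real analytic components. -/
def IsAnalyticBivector (χ : ∀ p : N, ⋀[ℝ]^2 (TangentSpace I p)) : Prop :=
  ∀ (p₀ : N) (l : ⋀[ℝ]^2 E →ₗ[ℝ] ℝ),
    ContMDiffOn I 𝓘(ℝ, ℝ) ω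
      (fun p => l (exteriorPower.map 2
        (mfderiv I 𝓘(ℝ, E) (extChartAt I p₀) p).toLinearMap (χ p)))
      (chartAt H p₀).source

/-- `f` is a real analytic immersion of the open set `U` into `ℝ⁷`. -/
def IsAnalyticImmersionOn (f : N → R7) (U : Set N) : Prop :=
  ContMDiffOn I 𝓘(ℝ, R7) ω f U ∧
    ∀ q ∈ U, Function.Injective (mfderiv I 𝓘(ℝ, R7) f q)

/-- `o` is an orientation of the open subset `U` of a 3-manifold: a choice of orientation of each
tangent space which, near each point `q₀` of `U`, is the orientation of a frame with constant
coefficients in the chart around `q₀`. -/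
def IsOrientationOn (o : ∀ q : N, Orientation ℝ (TangentSpace I q) (Fin 3)) (U : Set N) : Prop :=
  ∀ q₀ ∈ U, ∃ v : Fin 3 → E, ∀ᶠ q in 𝓝[U] q₀,
    ∃ b : Module.Basis (Fin 3) ℝ (TangentSpace I q),
      (∀ i, mfderiv I 𝓘(ℝ, E) (extChartAt I q₀) q (b i) = v i) ∧ b.orientation = o q

/-- `f` makes the open subset `U` of a 3-manifold into a nonsingular immersed associative 3-fold
in `ℝ⁷`: it is an immersion on `U` and, for some orientation of `U`, every tangent plane of the
image, with the induced orientation, is associative. -/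
def IsAssociativeImmersionOn (f : N → R7) (U : Set N) : Prop :=
  IsAnalyticImmersionOn I f U ∧
    ∃ o : ∀ q : N, Orientation ℝ (TangentSpace I q) (Fin 3), IsOrientationOn I o U ∧
      ∀ q ∈ U, ∃ h : Function.Injective (mfderiv I 𝓘(ℝ, R7) f q).toLinearMap,
        IsAssociativePlane (LinearMap.range (mfderiv I 𝓘(ℝ, R7) f q).toLinearMap)
          (Orientation.map (Fin 3) (LinearEquiv.ofInjective _ h) (o q))

/-- The family `ψ_t = Ψ t`, `|t| < ε`, is a real analytic solution of
`dψ_t/dt = (ψ_t)_*(χ)^{ab} φ_{abc} g^{cd}` with `ψ_0 = ψ`. Values of `Ψ t` for `|t| ≥ ε` play no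
role. -/
structure IsEvolution (χ : ∀ p : N, ⋀[ℝ]^2 (TangentSpace I p)) (ψ : N → R7) (ε : ℝ)
    (Ψ : ℝ → N → R7) : Prop where
  analytic : ContMDiffOn (𝓘(ℝ, ℝ).prod I) 𝓘(ℝ, R7) ω (fun q : ℝ × N => Ψ q.1 q.2)
    (Ioo (-ε) ε ×ˢ univ)
  initial : Ψ 0 = ψ
  evolution : ∀ t ∈ Ioo (-ε) ε, ∀ p : N,
    HasDerivAt (fun s => Ψ s p)
      (contractPhi (exteriorPower.map 2 (mfderiv I 𝓘(ℝ, R7) (Ψ t) p).toLinearMap (χ p))) t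

end Manifolds

/-! In a chart of P write χ = c(x) ∂₁ ∧ ∂₂. The evolution equation becomes ∂f/∂t = c · (∂₁f × ∂₂f),
where × is the cross product defined by φ. It is solved for ∂f/∂t and its right side is quadratic in
the spatial derivative, so it is a Cauchy–Kovalevskaya problem with data on t = 0. A formal solution
∑ tᵏ fₖ is fixed by recursion. It converges because the Taylor coefficients of D fₖ are dominated by
those of hₖ (1 - ρ z)^(-(3k+1)), with hₖ a geometric factor times the k-th Catalan number
(`derivBound_fderiv_evolutionCoeff`, `exists_analytic_evolution`). The difference of two analytic
solutions satisfies a linear equation, which forces all its derivatives to vanish at t = 0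
(`analytic_evolution_unique`). Uniqueness glues the chart solutions, and compactness of P leaves a
common positive lifetime (`exists_isEvolution`).

The geometry is pointwise. The vector u × v is orthogonal to u and v, |u × v|² = |u|²|v|² - ⟨u, v⟩²,
and φ(u, v, u × v) = |u × v|². So if the velocity is a nonzero multiple of u × v, with u, v the
images of a basis of the tangent plane of P, then DΨ is injective and φ restricted to its range is
the volume form of the orientation that φ itself induces
(`isAssociativePlane_range_of_eq_smul_crossPhi`). The velocity is nonzero at t = 0 because ψ is an
immersion and χ does not vanish, and by compactness it stays nonzero for small t.

If ψ is an embedding, Ψ is injective on {0} × P and locally injective near it, hence injective on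
some compact slab [-ε, ε] × P, where a continuous injection is an embedding. -/

/-! ### Cauchy estimates and series of real analytic functions -/

section AnalyticSeries

open Filter Metric
open scoped Nat NNReal ENNReal

variable {E V : Type*} [NormedAddCommGroup E] [NormedSpace ℝ E]
  [NormedAddCommGroup V] [NormedSpace ℝ V] [CompleteSpace V]

/-- Taylor's formula for a function whose derivatives obey Cauchy-type bounds on a ball. -/
theorem hasSum_taylor_of_iteratedFDeriv_bound {f : E → V} {z : E} {r M ρ : ℝ} (hρ : 0 ≤ ρ)
    (hf : AnalyticOnNhd ℝ f (ball z r))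
    (hb : ∀ n, ∀ w ∈ ball z r, ‖iteratedFDeriv ℝ n f w‖ ≤ n ! * (M * ρ ^ n))
    {y : E} (hy : ‖y‖ < r) (hρy : ρ * ‖y‖ < 1) :
    HasSum (fun n => (n ! : ℝ)⁻¹ • iteratedFDeriv ℝ n f z fun _ => y) (f (z + y)) := by
  have hmem : ∀ t ∈ Icc (0 : ℝ) 1, z + t • y ∈ ball z r := by
    intro t ht
    rw [mem_ball, dist_eq_norm, add_sub_cancel_left, norm_smul, Real.norm_of_nonneg ht.1]
    exact (mul_le_of_le_one_left (norm_nonneg _) ht.2).trans_lt hy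
  have hr : 0 < r := (norm_nonneg y).trans_lt hy
  have hterm : ∀ n, ∀ w ∈ ball z r, ‖iteratedFDeriv ℝ n f w fun _ => y‖
      ≤ n ! * (M * (ρ * ‖y‖) ^ n) := by
    intro n w hw
    refine (ContinuousMultilinearMap.le_opNorm _ _).trans ?_
    rw [Finset.prod_const, Finset.card_univ, Fintype.card_fin, mul_pow, ← mul_assoc M, ← mul_assoc]
    gcongr
    exact hb n w hw
  have hsum : Summable fun n => (n ! : ℝ)⁻¹ • iteratedFDeriv ℝ n f z fun _ => y := by
    refine Summable.of_norm_bounded (g := fun n => M * (ρ * ‖y‖) ^ n)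
      ((summable_geometric_of_lt_one (by positivity) hρy).mul_left M) fun n => ?_
    rw [norm_smul, norm_inv, Real.norm_natCast, inv_mul_le_iff₀ (by positivity)]
    exact hterm n z (mem_ball_self hr)
  refine (hsum.hasSum_iff_tendsto_nat).2 ?_
  rw [← tendsto_add_atTop_iff_nat 1]
  -- In the integral remainder the prefactor 1/n! meets the (n+1)! of the derivative bound, leaving
  -- a factor n + 1 that the geometric decay absorbs.
  have hrem : ∀ n : ℕ, ‖(∑ k ∈ Finset.range (n + 1),
      (k ! : ℝ)⁻¹ • iteratedFDeriv ℝ k f z fun _ => y) - f (z + y)‖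
      ≤ M * ((n + 1 : ℕ) * (ρ * ‖y‖) ^ (n + 1)) := by
    intro n
    rw [map_add_eq_sum_add_integral_iteratedFDeriv (n := n)
      (fun t ht => (hf _ (hmem t ht)).contDiffAt), sub_add_cancel_left, norm_neg, norm_smul,
      norm_inv, Real.norm_natCast, inv_mul_le_iff₀ (by positivity)]
    have : ∀ t ∈ uIoc (0 : ℝ) 1, ‖(1 - t) ^ n • iteratedFDeriv ℝ (n + 1) f (z + t • y) fun _ => y‖
        ≤ (n + 1)! * (M * (ρ * ‖y‖) ^ (n + 1)) := by
      intro t ht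
      rw [uIoc_of_le zero_le_one] at ht
      rw [norm_smul, norm_pow, Real.norm_of_nonneg (by linarith [ht.2])]
      refine (mul_le_of_le_one_left (norm_nonneg _)
        (pow_le_one₀ (by linarith [ht.2]) (by linarith [ht.1]))).trans ?_
      exact hterm _ _ (hmem t ⟨ht.1.le, ht.2⟩)
    refine (intervalIntegral.norm_integral_le_of_norm_le_const this).trans (le_of_eq ?_)
    rw [sub_zero, abs_one, mul_one, Nat.factorial_succ]
    push_cast
    ring
  rw [tendsto_iff_norm_sub_tendsto_zero]
  refine squeeze_zero (fun _ => norm_nonneg _) hrem ?_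
  have := (tendsto_self_mul_const_pow_of_lt_one (by positivity) hρy).const_mul M
  rw [mul_zero] at this
  exact (tendsto_add_atTop_iff_nat 1).2 this

/-- A series of analytic functions with geometric Cauchy-type bounds is analytic and may be
differentiated termwise. -/
theorem AnalyticOnNhd.tsum_of_iteratedFDeriv_bound {g : ℕ → E → V} {W : Set E} (hW : IsOpen W)
    (hg : ∀ k, AnalyticOnNhd ℝ (g k) W) {M ρ θ : ℝ} (hM : 0 ≤ M) (hρ : 0 < ρ) (hθ : 0 ≤ θ)
    (hθ1 : θ < 1)
    (hb : ∀ k n, ∀ z ∈ W, ‖iteratedFDeriv ℝ n (g k) z‖ ≤ n ! * (M * θ ^ k * ρ ^ n)) :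
    AnalyticOnNhd ℝ (fun z => ∑' k, g k z) W ∧
      ∀ z ∈ W, HasFDerivAt (fun z => ∑' k, g k z) (∑' k, fderiv ℝ (g k) z) z := by
  -- The sum is expanded about each z by adding the Taylor coefficients of the terms; the linear
  -- coefficient is tracked because it is the derivative.
  suffices key : ∀ z ∈ W, ∃ p : FormalMultilinearSeries ℝ E V,
      HasFPowerSeriesAt (fun z => ∑' k, g k z) p z ∧
        p 1 = ∑' k, iteratedFDeriv ℝ 1 (g k) z by
    refine ⟨fun z hz => ?_, fun z hz => ?_⟩
    · obtain ⟨p, hp, -⟩ := key z hz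
      exact hp.analyticAt
    · obtain ⟨p, hp, hp1⟩ := key z hz
      convert! hp.hasFDerivAt using 1
      rw [hp1]
      have hsum : Summable fun k => iteratedFDeriv ℝ 1 (g k) z := by
        refine Summable.of_norm_bounded (g := fun k => M * ρ * θ ^ k)
          ((summable_geometric_of_lt_one hθ hθ1).mul_left _) fun k => ?_
        refine (hb k 1 z hz).trans (le_of_eq ?_)
        simp
        ring
      erw [(continuousMultilinearCurryFin1 ℝ E V).toContinuousLinearEquiv.map_tsum]
      refine tsum_congr fun k => ?_
      ext v
      simp [iteratedFDeriv_one_apply]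
  intro z hz
  obtain ⟨r₀, hr₀, hrW⟩ := Metric.isOpen_iff.1 hW z hz
  -- The first bound keeps the ball inside W; the second gives ρ‖y‖ ≤ 1/2, so that the Taylor series
  -- converge geometrically.
  set r : ℝ := min r₀ (2 * ρ)⁻¹ with hrdef
  have hr : 0 < r := by positivity
  have hrρ : ρ * r ≤ 1 / 2 := by
    calc ρ * r ≤ ρ * (2 * ρ)⁻¹ := by gcongr; exact min_le_right _ _
      _ = 1 / 2 := by field_simp
  set p : FormalMultilinearSeries ℝ E V :=
    fun n => ∑' k, (n ! : ℝ)⁻¹ • iteratedFDeriv ℝ n (g k) z with hp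
  have hterm : ∀ k n, ‖(n ! : ℝ)⁻¹ • iteratedFDeriv ℝ n (g k) z‖ ≤ M * θ ^ k * ρ ^ n := by
    intro k n
    rw [norm_smul, norm_inv, Real.norm_natCast, inv_mul_le_iff₀ (by positivity)]
    exact hb k n z hz
  have hgeo := summable_geometric_of_lt_one hθ hθ1
  have hsumk : ∀ n, Summable fun k => (n ! : ℝ)⁻¹ • iteratedFDeriv ℝ n (g k) z := fun n =>
    Summable.of_norm_bounded (g := fun k => M * θ ^ k * ρ ^ n)
      ((hgeo.mul_left M).mul_right _) fun k => hterm k n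
  have hpn : ∀ n, ‖p n‖ ≤ M * (∑' k, θ ^ k) * ρ ^ n := by
    intro n
    rw [← tsum_mul_left, ← tsum_mul_right]
    exact tsum_of_norm_bounded ((hgeo.mul_left M).mul_right _).hasSum fun k => hterm k n
  refine ⟨p, ⟨ENNReal.ofReal r, ?_, by simpa using hr, ?_⟩, ?_⟩
  · refine p.le_radius_of_bound (M * ∑' k, θ ^ k) fun n => ?_
    have hS : 0 ≤ M * ∑' k, θ ^ k := mul_nonneg hM (tsum_nonneg fun k => by positivity)
    rw [Real.coe_toNNReal _ hr.le]
    calc ‖p n‖ * r ^ n ≤ M * (∑' k, θ ^ k) * ρ ^ n * r ^ n := by gcongr; exact hpn n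
      _ = M * (∑' k, θ ^ k) * (ρ * r) ^ n := by rw [mul_assoc, mul_pow]
      _ ≤ _ := mul_le_of_le_one_right hS (pow_le_one₀ (by positivity) (by linarith))
  · intro y hy
    rw [Metric.eball_ofReal, mem_ball_zero_iff] at hy
    have hyr₀ : ‖y‖ < r₀ := hy.trans_le (min_le_left _ _)
    have hρy : ρ * ‖y‖ ≤ 1 / 2 := le_trans (by gcongr) hrρ
    have htay : ∀ k, HasSum (fun n => (n ! : ℝ)⁻¹ • iteratedFDeriv ℝ n (g k) z fun _ => y)
        (g k (z + y)) := fun k =>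
      hasSum_taylor_of_iteratedFDeriv_bound hρ.le ((hg k).mono hrW)
        (fun n w hw => hb k n w (hrW hw)) hyr₀ (by linarith)
    -- Absolute convergence of the double series: summing over n first gives ∑ gₖ(z + y), summing
    -- over k first gives the power series p.
    have hdouble : Summable fun q : ℕ × ℕ =>
        (q.2 ! : ℝ)⁻¹ • iteratedFDeriv ℝ q.2 (g q.1) z fun _ => y := by
      refine Summable.of_norm_bounded (g := fun q : ℕ × ℕ => (M * θ ^ q.1) * (ρ * ‖y‖) ^ q.2)
        ((hgeo.mul_left M).mul_of_nonneg
          (summable_geometric_of_lt_one (by positivity) (by linarith))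
          (fun k => by positivity) (fun k => by positivity)) fun q => ?_
      have := ((q.2 ! : ℝ)⁻¹ • iteratedFDeriv ℝ q.2 (g q.1) z).le_opNorm fun _ => y
      rw [Finset.prod_const, Finset.card_univ, Fintype.card_fin] at this
      refine this.trans ?_
      rw [mul_pow, ← mul_assoc]
      gcongr
      exact hterm q.1 q.2
    have h1 : HasSum (fun k => g k (z + y)) (∑' q : ℕ × ℕ,
        (q.2 ! : ℝ)⁻¹ • iteratedFDeriv ℝ q.2 (g q.1) z fun _ => y) :=
      hdouble.hasSum.prod_fiberwise htay
    rw [h1.tsum_eq]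
    have h2 := (Equiv.prodComm ℕ ℕ).hasSum_iff.2 hdouble.hasSum
    refine h2.prod_fiberwise fun n => ?_
    have h3 := (hsumk n).hasSum
    exact ContinuousMultilinearMap.hasSum_eval h3 _
  · simp [hp]

/-- The derivatives of an analytic function obey Cauchy-type bounds, locally uniformly. -/
theorem AnalyticAt.exists_iteratedFDeriv_bound {f : E → V} {x : E} (hf : AnalyticAt ℝ f x) :
    ∃ M ρ : ℝ, 0 < M ∧ 0 < ρ ∧
      ∀ᶠ y in 𝓝 x, ∀ n, ‖iteratedFDeriv ℝ n f y‖ ≤ n ! * (M * ρ ^ n) := by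
  obtain ⟨p, r, hp⟩ := hf
  obtain ⟨s, hs0, hs⟩ := ENNReal.lt_iff_exists_nnreal_btwn.1 hp.r_pos
  have hs0 : 0 < s := by simpa using hs0
  -- Half of s for moving the centre and half for the recentred expansion: together they stay below
  -- the radius of p.
  set a : ℝ≥0 := s / 2 with ha
  have ha0 : 0 < a := by positivity
  have haa : ((a + a : ℝ≥0) : ℝ≥0∞) < p.radius := by
    rw [ha, add_halves]; exact hs.trans_le hp.r_le
  have hS := p.changeOriginSeries_summable_aux₁ (r := a) (r' := a) (by exact_mod_cast haa)
  set S := ∑' s : Σ k l : ℕ, { s : Finset (Fin (k + l)) // s.card = l },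
      ‖p (s.1 + s.2.1)‖₊ * a ^ s.2.1 * a ^ s.1 with hSdef
  -- S bounds aⁿ times the n-th recentred coefficient for every n and every nearby centre; adding 1
  -- makes the constant positive.
  refine ⟨S + 1, (a : ℝ)⁻¹, by positivity, by positivity, ?_⟩
  filter_upwards [Metric.ball_mem_nhds x (NNReal.coe_pos.2 ha0)] with y hy n
  have hyx : ‖y - x‖₊ < a := by
    rw [← NNReal.coe_lt_coe, coe_nnnorm, ← dist_eq_norm]; exact hy
  have hyr : (‖y - x‖₊ : ℝ≥0∞) < r :=
    (ENNReal.coe_lt_coe.2 (hyx.trans_le (by rw [ha]; exact half_le_self s.2))).trans hs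
  have hq := hp.changeOrigin hyr
  rw [add_sub_cancel] at hq
  have hnorm : ‖p.changeOrigin (y - x) n‖ ≤ (S + 1) * (a : ℝ)⁻¹ ^ n := by
    rw [inv_pow, ← div_eq_mul_inv, le_div_iff₀ (by positivity)]
    have h1 : ‖p.changeOrigin (y - x) n‖₊ * a ^ n ≤ S := by
      have h2 := p.nnnorm_changeOrigin_le n (hyr.trans_le hp.r_le)
      have hsig := (NNReal.summable_sigma.1 hS)
      have hl := hsig.1 n
      calc ‖p.changeOrigin (y - x) n‖₊ * a ^ n
          ≤ (∑' s : Σ l : ℕ, { s : Finset (Fin (n + l)) // s.card = l },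
              ‖p (n + s.1)‖₊ * a ^ s.1) * a ^ n := by
            gcongr
            refine h2.trans (Summable.tsum_le_tsum (fun s => ?_)
              (p.changeOriginSeries_summable_aux₂ (hyr.trans_le hp.r_le) n)
              (p.changeOriginSeries_summable_aux₂ (lt_of_le_of_lt ?_ haa) n))
            · gcongr
            · exact_mod_cast le_self_add
        _ = ∑' s : Σ l : ℕ, { s : Finset (Fin (n + l)) // s.card = l },
              ‖p (n + s.1)‖₊ * a ^ s.1 * a ^ n := (NNReal.tsum_mul_right _ _).symm
        _ ≤ S := by
            rw [hSdef, hS.tsum_sigma' hsig.1]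
            exact hsig.2.le_tsum n (fun _ _ => zero_le)
    have h1' : ‖p.changeOrigin (y - x) n‖ * (a : ℝ) ^ n ≤ S := by exact_mod_cast h1
    linarith
  refine ContinuousMultilinearMap.opNorm_le_bound (by positivity) fun v => ?_
  -- The n-th derivative symmetrises the n-th coefficient over n! permutations, which is the source
  -- of the factorial.
  rw [hq.iteratedFDeriv_eq_sum_of_completeSpace]
  calc ‖∑ σ : Equiv.Perm (Fin n), p.changeOrigin (y - x) n fun i => v (σ i)‖
      ≤ ∑ σ : Equiv.Perm (Fin n), (S + 1) * (a : ℝ)⁻¹ ^ n * ∏ i, ‖v i‖ := by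
        refine norm_sum_le_of_le _ fun σ _ => ?_
        refine (ContinuousMultilinearMap.le_opNorm _ _).trans ?_
        rw [Equiv.prod_comp σ fun i => ‖v i‖]
        gcongr
    _ = _ := by
        rw [Finset.sum_const, Finset.card_univ, Fintype.card_perm, Fintype.card_fin,
          nsmul_eq_mul, mul_assoc, mul_assoc, mul_assoc]

end AnalyticSeries

/-! ### Majorants of the form (1 - ρ z)^(-(p+1)) -/

section MajorantSeries

open scoped Nat

/-- The coefficients of the power series of `(1 - ρ z)⁻¹ ^ (p + 1)`. -/
noncomputable def geomCoeff (ρ : ℝ) (p n : ℕ) : ℝ := ρ ^ n * (n + p).choose p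

/-- Compare the coefficients of zⁿ in (1 - z)^(-(p+1)) (1 - z)^(-(q+1)) = (1 - z)^(-(p+q+2)). -/
theorem sum_choose_mul_choose (p q n : ℕ) :
    ∑ i ∈ Finset.range (n + 1), ((i + p).choose p : ℝ) * ((n - i + q).choose q : ℝ)
      = ((n + (p + q + 1)).choose (p + q + 1) : ℝ) := by
  have h : ((PowerSeries.invOneSubPow ℝ (p + 1)).val * (PowerSeries.invOneSubPow ℝ (q + 1)).val)
      = (PowerSeries.invOneSubPow ℝ (p + q + 1 + 1)).val := by
    rw [← Units.val_mul, ← PowerSeries.invOneSubPow_add]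
    congr 2
    ring
  have h2 := congrArg (PowerSeries.coeff n) h
  rw [PowerSeries.coeff_mul] at h2
  simp only [PowerSeries.invOneSubPow_val_succ_eq_mk_add_choose, PowerSeries.coeff_mk] at h2
  rw [Finset.Nat.sum_antidiagonal_eq_sum_range_succ
    (fun i j => ((p + i).choose p : ℝ) * ((q + j).choose q : ℝ))] at h2
  rw [add_comm n (p + q + 1), ← h2]
  exact Finset.sum_congr rfl fun i _ => by rw [add_comm i, add_comm (n - i)]

theorem sum_geomCoeff_mul_geomCoeff (ρ : ℝ) (p q n : ℕ) :
    ∑ i ∈ Finset.range (n + 1), geomCoeff ρ p i * geomCoeff ρ q (n - i)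
      = geomCoeff ρ (p + q + 1) n := by
  rw [geomCoeff, ← sum_choose_mul_choose, Finset.mul_sum]
  refine Finset.sum_congr rfl fun i hi => ?_
  rw [← Nat.add_sub_of_le (Nat.lt_succ_iff.1 (Finset.mem_range.1 hi)), pow_add]
  simp only [geomCoeff, add_tsub_cancel_left]
  ring

theorem geomCoeff_nonneg {ρ : ℝ} (hρ : 0 ≤ ρ) (p n : ℕ) : 0 ≤ geomCoeff ρ p n := by
  unfold geomCoeff; positivity

theorem geomCoeff_zero (ρ : ℝ) (n : ℕ) : geomCoeff ρ 0 n = ρ ^ n := by simp [geomCoeff]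

theorem geomCoeff_le {ρ : ℝ} (hρ : 0 ≤ ρ) (p n : ℕ) : geomCoeff ρ p n ≤ 2 ^ p * (2 * ρ) ^ n := by
  have h : ((n + p).choose p : ℝ) ≤ 2 ^ (n + p) := by exact_mod_cast Nat.choose_le_two_pow _ _
  calc geomCoeff ρ p n ≤ ρ ^ n * 2 ^ (n + p) := by unfold geomCoeff; gcongr
    _ = _ := by rw [mul_pow, pow_add]; ring

theorem succ_mul_geomCoeff_succ (ρ : ℝ) (p n : ℕ) :
    (n + 1 : ℝ) * geomCoeff ρ p (n + 1) = ρ * (p + 1) * geomCoeff ρ (p + 1) n := by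
  have h := Nat.choose_succ_right_eq (n + 1 + p) p
  rw [show n + 1 + p - p = n + 1 by omega] at h
  have h' : ((n + 1 + p).choose (p + 1) : ℝ) * (p + 1) = (n + 1 + p).choose p * (n + 1) := by
    exact_mod_cast h
  rw [geomCoeff, geomCoeff, show n + (p + 1) = n + 1 + p by ring, pow_succ]
  linear_combination (-ρ ^ n * ρ) * h'

variable {E F G V : Type*} [NormedAddCommGroup E] [NormedSpace ℝ E]
  [NormedAddCommGroup F] [NormedSpace ℝ F] [NormedAddCommGroup G] [NormedSpace ℝ G]
  [NormedAddCommGroup V] [NormedSpace ℝ V]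

/-- The Taylor coefficients of `f` at `x` are dominated by the sequence `a`. -/
def DerivBound (f : E → F) (x : E) (a : ℕ → ℝ) : Prop :=
  ∀ n, ‖iteratedFDeriv ℝ n f x‖ ≤ n ! * a n

namespace DerivBound

theorem mono {f : E → F} {x : E} {a b : ℕ → ℝ} (h : DerivBound f x a) (hab : ∀ n, a n ≤ b n) :
    DerivBound f x b := fun n =>
  (h n).trans (by gcongr; exact hab n)

/-- In Leibniz' formula the binomial coefficient times i! (n-i)! is n!, so bounds normalised by
factorials multiply like power series. -/
theorem bilinear (B : F →L[ℝ] G →L[ℝ] V) {f : E → F} {g : E → G} {U : Set E} (hU : IsOpen U)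
    (hf : ContDiffOn ℝ ω f U) (hg : ContDiffOn ℝ ω g U) {x : E} (hx : x ∈ U) {a b : ℕ → ℝ}
    (ha : DerivBound f x a) (hb : DerivBound g x b) :
    DerivBound (fun y => B (f y) (g y)) x
      fun n => ‖B‖ * ∑ i ∈ Finset.range (n + 1), a i * b (n - i) := by
  intro n
  have h := B.norm_iteratedFDerivWithin_le_of_bilinear hf hg hU.uniqueDiffOn hx (n := n) le_top
  simp only [iteratedFDerivWithin_of_isOpen _ hU hx] at h
  refine h.trans ?_
  change _ ≤ (n ! : ℝ) * (‖B‖ * ∑ i ∈ Finset.range (n + 1), a i * b (n - i))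
  rw [mul_left_comm, Finset.mul_sum _ _ (n ! : ℝ)]
  refine mul_le_mul_of_nonneg_left (Finset.sum_le_sum fun i hi => ?_) (norm_nonneg B)
  have hin : i ≤ n := Nat.lt_succ_iff.1 (Finset.mem_range.1 hi)
  have hc : (n ! : ℝ) = n.choose i * i ! * (n - i)! := by
    exact_mod_cast (Nat.choose_mul_factorial_mul_factorial hin).symm
  rw [hc]
  calc (n.choose i : ℝ) * ‖iteratedFDeriv ℝ i f x‖ * ‖iteratedFDeriv ℝ (n - i) g x‖
      ≤ n.choose i * (i ! * a i) * ((n - i)! * b (n - i)) := by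
        have h1 := ha i
        have h2 := hb (n - i)
        have h3 : 0 ≤ (i ! : ℝ) * a i := (norm_nonneg _).trans h1
        gcongr
    _ = _ := by ring

theorem bilinear_geomCoeff (B : F →L[ℝ] G →L[ℝ] V) {f : E → F} {g : E → G} {U : Set E}
    (hU : IsOpen U) (hf : ContDiffOn ℝ ω f U) (hg : ContDiffOn ℝ ω g U) {x : E} (hx : x ∈ U)
    {ρ a b : ℝ} {p q : ℕ} (ha : DerivBound f x fun n => a * geomCoeff ρ p n)
    (hb : DerivBound g x fun n => b * geomCoeff ρ q n) :
    DerivBound (fun y => B (f y) (g y)) x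
      fun n => ‖B‖ * (a * b) * geomCoeff ρ (p + q + 1) n := by
  refine (ha.bilinear B hU hf hg hx hb).mono fun n => le_of_eq ?_
  rw [← sum_geomCoeff_mul_geomCoeff, Finset.mul_sum, Finset.mul_sum]
  exact Finset.sum_congr rfl fun i _ => by ring

/-- Majorants may be differentiated: the derivative of (1 - ρ z)^(-(p+1)) is ρ (p+1) (1 - ρ
z)^(-(p+2)). -/
theorem fderiv_geomCoeff {f : E → F} {x : E} {ρ a : ℝ} {p : ℕ}
    (ha : DerivBound f x fun n => a * geomCoeff ρ p n) :
    DerivBound (fderiv ℝ f) x fun n => a * (ρ * (p + 1)) * geomCoeff ρ (p + 1) n := by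
  intro n
  rw [norm_iteratedFDeriv_fderiv]
  refine (ha (n + 1)).trans (le_of_eq ?_)
  rw [Nat.factorial_succ]
  push_cast
  linear_combination (n ! : ℝ) * a * succ_mul_geomCoeff_succ ρ p n

/-- Integration of a majorant: the factorial only improves when the order rises by one, so just
order zero needs its own bound. -/
theorem of_fderiv {f : E → F} {x : E} {a ρ : ℝ} (hρ : 0 < ρ)
    (h0 : ‖f x‖ ≤ a) (h : DerivBound (fderiv ℝ f) x fun n => a * ρ * ρ ^ n) :
    DerivBound f x fun n => a * ρ ^ n := by
  have ha : 0 ≤ a := (norm_nonneg _).trans h0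
  rintro (_ | n)
  · simpa using h0
  · rw [← norm_iteratedFDeriv_fderiv]
    refine (h n).trans ?_
    change (n ! : ℝ) * (a * ρ * ρ ^ n) ≤ (n + 1)! * (a * ρ ^ (n + 1))
    rw [mul_assoc a, ← pow_succ']
    gcongr
    exact Nat.le_succ n

theorem const_smul {f : E → F} {x : E} {a : ℕ → ℝ} (hf : ContDiffAt ℝ ω f x)
    (h : DerivBound f x a) {s : ℝ} (hs : 0 ≤ s) : DerivBound (fun y => s • f y) x
      fun n => s * a n := by
  intro n
  change _ ≤ (n ! : ℝ) * (s * a n)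
  rw [iteratedFDeriv_const_smul_apply' (hf.of_le le_top), norm_smul, Real.norm_of_nonneg hs,
    mul_left_comm]
  gcongr
  exact h n

theorem sum {ι : Type*} {s : Finset ι} {f : ι → E → F} {x : E} {a : ι → ℕ → ℝ}
    (hf : ∀ i ∈ s, ContDiffAt ℝ ω (f i) x) (h : ∀ i ∈ s, DerivBound (f i) x (a i)) :
    DerivBound (fun y => ∑ i ∈ s, f i y) x fun n => ∑ i ∈ s, a i n := by
  classical
  induction s using Finset.induction_on with
  | empty =>
    intro n
    simp
  | insert i s hi ih =>
    intro n
    simp only [Finset.sum_insert hi]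
    rw [fun_iteratedFDeriv_add_apply ((hf i (Finset.mem_insert_self i s)).of_le le_top)
      ((ContDiffAt.sum fun j hj => hf j (Finset.mem_insert_of_mem hj)).of_le le_top)]
    refine (norm_add_le _ _).trans ?_
    rw [mul_add]
    exact add_le_add (h i (Finset.mem_insert_self i s) n)
      (ih (fun j hj => hf j (Finset.mem_insert_of_mem hj))
        (fun j hj => h j (Finset.mem_insert_of_mem hj)) n)

end DerivBound

end MajorantSeries

/-! ### The formal solution and bounds on its coefficients -/

section CauchyKovalevskaya

set_option maxSynthPendingDepth 3

open Filter
open Finset.HasAntidiagonal (antidiagonal)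
open scoped Nat

variable {E F G V : Type*} [NormedAddCommGroup E] [NormedSpace ℝ E]
  [NormedAddCommGroup F] [NormedSpace ℝ F] [NormedAddCommGroup G] [NormedSpace ℝ G]
  [NormedAddCommGroup V] [NormedSpace ℝ V]

/-- The Cauchy product of two absolutely convergent series, for a bilinear map. -/
theorem ContinuousLinearMap.hasSum_antidiagonal_of_summable_norm [CompleteSpace F]
    [CompleteSpace G] [CompleteSpace V] (B : F →L[ℝ] G →L[ℝ] V) {a : ℕ → F} {b : ℕ → G}
    (ha : Summable fun k => ‖a k‖) (hb : Summable fun k => ‖b k‖) :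
    HasSum (fun k => ∑ q ∈ antidiagonal k, B (a q.1) (b q.2))
      (B (∑' k, a k) (∑' k, b k)) := by
  have hsum : Summable fun q : ℕ × ℕ => B (a q.1) (b q.2) := by
    refine Summable.of_norm_bounded (g := fun q : ℕ × ℕ => ‖B‖ * (‖a q.1‖ * ‖b q.2‖))
      ((ha.mul_of_nonneg hb (fun _ => norm_nonneg _) fun _ => norm_nonneg _).mul_left _)
      fun q => ?_
    rw [← mul_assoc]
    exact B.le_opNorm₂ _ _
  have h1 : HasSum (fun i => B (a i) (∑' k, b k)) (B (∑' k, a k) (∑' k, b k)) :=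
    (B.flip (∑' k, b k)).hasSum ha.of_norm.hasSum
  have h2 : HasSum (fun i => B (a i) (∑' k, b k)) (∑' q : ℕ × ℕ, B (a q.1) (b q.2)) :=
    hsum.hasSum.prod_fiberwise fun i => (B (a i)).hasSum hb.of_norm.hasSum
  rw [h1.unique h2]
  have h3 := Finset.HasAntidiagonal.sigmaAntidiagonalEquivProd.hasSum_iff.2 hsum.hasSum
  refine h3.sigma fun k => ?_
  have := hasSum_fintype
    fun q : antidiagonal k => B (a (q : ℕ × ℕ).1) (b (q : ℕ × ℕ).2)
  rw [Finset.univ_eq_attach, Finset.sum_attach (antidiagonal k)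
    fun q => B (a q.1) (b q.2)] at this
  exact this

variable (B : (E →L[ℝ] V) →L[ℝ] (E →L[ℝ] V) →L[ℝ] V) (c : E → ℝ) (f₀ : E → V)

/-- The coefficients of the formal solution `∑ tᵏ fₖ` of `∂f/∂t = c • B (Df) (Df)` with initial
value `f₀`. -/
noncomputable def evolutionCoeff : ℕ → E → V
  | 0 => f₀
  | k + 1 => fun x => (k + 1 : ℝ)⁻¹ • c x • ∑ i : Fin (k + 1),
      B (fderiv ℝ (evolutionCoeff i) x) (fderiv ℝ (evolutionCoeff (k - i)) x)
  decreasing_by all_goals omega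

theorem evolutionCoeff_zero : evolutionCoeff B c f₀ 0 = f₀ := by rw [evolutionCoeff]

theorem evolutionCoeff_succ (k : ℕ) : evolutionCoeff B c f₀ (k + 1) = fun x =>
    (k + 1 : ℝ)⁻¹ • c x • ∑ q ∈ antidiagonal k,
      B (fderiv ℝ (evolutionCoeff B c f₀ q.1) x) (fderiv ℝ (evolutionCoeff B c f₀ q.2) x) := by
  rw [evolutionCoeff]
  funext x
  rw [Finset.Nat.sum_antidiagonal_eq_sum_range_succ fun i j =>
    B (fderiv ℝ (evolutionCoeff B c f₀ i) x) (fderiv ℝ (evolutionCoeff B c f₀ j) x)]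
  rw [Fin.sum_univ_eq_sum_range fun i =>
    B (fderiv ℝ (evolutionCoeff B c f₀ i) x) (fderiv ℝ (evolutionCoeff B c f₀ (k - i)) x)]

variable {B c f₀} [CompleteSpace V]

theorem analyticOnNhd_evolutionCoeff {U : Set E} (hc : AnalyticOnNhd ℝ c U)
    (hf : AnalyticOnNhd ℝ f₀ U) (k : ℕ) : AnalyticOnNhd ℝ (evolutionCoeff B c f₀ k) U := by
  induction k using Nat.strong_induction_on with
  | _ k ih =>
    rcases k with _ | k
    · rwa [evolutionCoeff_zero]
    · rw [evolutionCoeff_succ]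
      refine analyticOnNhd_const.smul (hc.smul ?_)
      refine Finset.analyticOnNhd_fun_sum _ fun q hq x hx => ?_
      have h1 := (ih q.1 (by have := Finset.HasAntidiagonal.mem_antidiagonal.1 hq; omega)).fderiv x hx
      have h2 := (ih q.2 (by have := Finset.HasAntidiagonal.mem_antidiagonal.1 hq; omega)).fderiv x hx
      exact (B.analyticAt_bilinear _).comp₂ h1 h2

/-- The bounds on the coefficients of the formal solution given by the explicit majorant
`∑ h_k t^k (1 - ρ z) ^ (-(3 k + 1))`, where `h_k` is a multiple of the `k`-th Catalan number. -/
theorem derivBound_evolutionCoeff_succ {U : Set E} (hU : IsOpen U) (hc : AnalyticOnNhd ℝ c U)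
    (hf : AnalyticOnNhd ℝ f₀ U) {M ρ : ℝ} {h : ℕ → ℝ}
    (hcb : ∀ x ∈ U, DerivBound c x fun n => M * geomCoeff ρ 0 n) (hM : 0 ≤ M) (hρ : 0 ≤ ρ) {k : ℕ}
    (hh : ∀ j ≤ k, 0 ≤ h j)
    (hk : ∀ j ≤ k, ∀ x ∈ U, DerivBound (fderiv ℝ (evolutionCoeff B c f₀ j)) x
      fun n => h j * geomCoeff ρ (3 * j) n) {x : E} (hx : x ∈ U) :
    DerivBound (evolutionCoeff B c f₀ (k + 1)) x fun n =>
      (k + 1 : ℝ)⁻¹ * (M * (‖B‖ * ∑ q ∈ antidiagonal k, h q.1 * h q.2)) *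
        geomCoeff ρ (3 * k + 2) n := by
  have han : ∀ j, ContDiffOn ℝ ω (fderiv ℝ (evolutionCoeff B c f₀ j)) U := fun j =>
    (analyticOnNhd_evolutionCoeff hc hf j).fderiv.contDiffOn hU.uniqueDiffOn
  have hBan : ∀ q : ℕ × ℕ, ContDiffOn ℝ ω (fun x => B (fderiv ℝ (evolutionCoeff B c f₀ q.1) x)
      (fderiv ℝ (evolutionCoeff B c f₀ q.2) x)) U := fun q =>
    B.isBoundedBilinearMap.contDiff.comp_contDiffOn ((han q.1).prodMk (han q.2))
  have hat : ∀ {W : Type _} [NormedAddCommGroup W] [NormedSpace ℝ W] {g : E → W},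
      ContDiffOn ℝ ω g U → ContDiffAt ℝ ω g x := fun hg => hg.contDiffAt (hU.mem_nhds hx)
  have h1 : DerivBound (fun y => ∑ q ∈ antidiagonal k,
      B (fderiv ℝ (evolutionCoeff B c f₀ q.1) y) (fderiv ℝ (evolutionCoeff B c f₀ q.2) y)) x
      fun n => (‖B‖ * ∑ q ∈ antidiagonal k, h q.1 * h q.2) * geomCoeff ρ (3 * k + 1) n := by
    refine (DerivBound.sum (a := fun q n => ‖B‖ * (h q.1 * h q.2) * geomCoeff ρ (3 * k + 1) n)
      (fun q _ => hat (hBan q)) fun q hq => ?_).mono fun n => ?_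
    · have hq' := Finset.HasAntidiagonal.mem_antidiagonal.1 hq
      have := (hk q.1 (by omega) x hx).bilinear_geomCoeff B hU (han q.1) (han q.2) hx
        (hk q.2 (by omega) x hx)
      rwa [show 3 * q.1 + 3 * q.2 + 1 = 3 * k + 1 by omega] at this
    · rw [← Finset.sum_mul, ← Finset.mul_sum]
  have h2 := (hcb x hx).bilinear_geomCoeff (ContinuousLinearMap.lsmul ℝ ℝ : ℝ →L[ℝ] V →L[ℝ] V) hU
    (hc.contDiffOn hU.uniqueDiffOn) (ContDiffOn.sum fun q _ => hBan q) hx h1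
  rw [show 0 + (3 * k + 1) + 1 = 3 * k + 2 by ring] at h2
  rw [evolutionCoeff_succ]
  refine (h2.const_smul (s := (k + 1 : ℝ)⁻¹) ?_ (by positivity)).mono fun n => ?_
  · exact hat ((hc.contDiffOn hU.uniqueDiffOn).smul (ContDiffOn.sum fun q _ => hBan q))
  · have hS : 0 ≤ ∑ q ∈ antidiagonal k, h q.1 * h q.2 :=
      Finset.sum_nonneg fun q hq => mul_nonneg
        (hh _ (by have := Finset.HasAntidiagonal.mem_antidiagonal.1 hq; omega))
        (hh _ (by have := Finset.HasAntidiagonal.mem_antidiagonal.1 hq; omega))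
    have hg := geomCoeff_nonneg hρ (3 * k + 2) n
    rw [mul_assoc (‖_‖), mul_assoc _ (M * _)]
    refine mul_le_mul_of_nonneg_left ?_ (by positivity)
    exact mul_le_of_le_one_left (by positivity) ContinuousLinearMap.opNorm_lsmul_le

/-- One step multiplies two majorants and that of c, reaching exponent 3k + 3, and then
differentiates, which yields a factor 3(k+1). The division by k + 1 cancels all of it but 3, so the
constants satisfy h_{k+1} = 3‖B‖Mρ ∑ hᵢhⱼ over i + j = k, the Catalan recursion up to scaling. -/
theorem derivBound_fderiv_evolutionCoeff {U : Set E} (hU : IsOpen U) (hc : AnalyticOnNhd ℝ c U)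
    (hf : AnalyticOnNhd ℝ f₀ U) {M M₀ ρ : ℝ} (hM : 0 ≤ M) (hM₀ : 0 ≤ M₀) (hρ : 0 ≤ ρ)
    (hcb : ∀ x ∈ U, DerivBound c x fun n => M * geomCoeff ρ 0 n)
    (hfb : ∀ x ∈ U, DerivBound (fderiv ℝ f₀) x fun n => M₀ * geomCoeff ρ 0 n) (k : ℕ) :
    ∀ x ∈ U, DerivBound (fderiv ℝ (evolutionCoeff B c f₀ k)) x fun n =>
      (M₀ * (3 * ‖B‖ * M * ρ * M₀) ^ k * catalan k) * geomCoeff ρ (3 * k) n := by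
  induction k using Nat.strong_induction_on with
  | _ k ih =>
    rcases k with _ | k
    · simpa [evolutionCoeff_zero] using hfb
    · intro x hx
      have h1 := derivBound_evolutionCoeff_succ hU hc hf hcb hM hρ
        (h := fun j => M₀ * (3 * ‖B‖ * M * ρ * M₀) ^ j * catalan j) (k := k)
        (fun j _ => by positivity) (fun j hj => ih j (Nat.lt_succ_of_le hj)) hx
      have h2 := h1.fderiv_geomCoeff
      rw [show 3 * k + 2 + 1 = 3 * (k + 1) by ring] at h2
      refine h2.mono fun n => le_of_eq ?_
      congr 1
      have hS : ∑ q ∈ antidiagonal k, (M₀ * (3 * ‖B‖ * M * ρ * M₀) ^ q.1 * catalan q.1) *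
          (M₀ * (3 * ‖B‖ * M * ρ * M₀) ^ q.2 * catalan q.2)
          = M₀ * M₀ * (3 * ‖B‖ * M * ρ * M₀) ^ k * catalan (k + 1) := by
        rw [catalan_succ']
        push_cast
        rw [Finset.mul_sum]
        refine Finset.sum_congr rfl fun q hq => ?_
        rw [← Finset.HasAntidiagonal.mem_antidiagonal.1 hq, pow_add]
        ring
      rw [hS, pow_succ]
      push_cast
      field_simp
      ring

/-- Geometric bounds, uniform on `U`, on the coefficients of the formal solution. -/
theorem exists_derivBound_evolutionCoeff {U : Set E} (hU : IsOpen U) (hc : AnalyticOnNhd ℝ c U)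
    (hf : AnalyticOnNhd ℝ f₀ U) {M ρ : ℝ} (hM : 0 < M) (hρ : 0 < ρ)
    (hcb : ∀ x ∈ U, DerivBound c x fun n => M * ρ ^ n)
    (hfb : ∀ x ∈ U, DerivBound f₀ x fun n => M * ρ ^ n) :
    ∃ M' K ρ' : ℝ, 0 < M' ∧ 0 < K ∧ 0 < ρ' ∧ ∀ k, ∀ x ∈ U,
      DerivBound (evolutionCoeff B c f₀ k) x fun n => M' * K ^ k * ρ' ^ n := by
  have hρ2 : 0 < 2 * ρ := by positivity
  -- Differentiating f₀ costs a factor n + 1 ≤ 2 · 2ⁿ, paid for by this 2 and by passing from ρ to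
  -- 2ρ.
  set M₀ := M * ρ * 2 with hM₀
  set κ := 3 * ‖B‖ * M * (2 * ρ) * M₀ with hκ
  have hκ0 : 0 ≤ κ := by positivity
  -- Here 32 = 4 · 2³: the Catalan numbers are at most 4ᵏ, and `geomCoeff_le` with p = 3k costs
  -- 2^(3k). The added 1 makes K ≥ 1.
  set K := 32 * κ + 1 with hK
  have hcb' : ∀ x ∈ U, DerivBound c x fun n => M * geomCoeff (2 * ρ) 0 n := fun x hx =>
    (hcb x hx).mono fun n => by
      rw [geomCoeff_zero]
      gcongr
      linarith
  have hfb' : ∀ x ∈ U, DerivBound (fderiv ℝ f₀) x fun n => M₀ * geomCoeff (2 * ρ) 0 n := by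
    intro x hx
    have h1 : DerivBound f₀ x fun n => M * geomCoeff ρ 0 n := by
      simpa only [geomCoeff_zero] using hfb x hx
    refine h1.fderiv_geomCoeff.mono fun n => ?_
    have := geomCoeff_le hρ.le 1 n
    rw [geomCoeff_zero, hM₀, mul_assoc _ 2]
    simpa using mul_le_mul_of_nonneg_left this (by positivity : 0 ≤ M * ρ)
  have hD := derivBound_fderiv_evolutionCoeff (B := B) hU hc hf hM.le (by positivity) hρ2.le
    hcb' hfb'
  have hcat : ∀ k, (catalan k : ℝ) ≤ 4 ^ k := by
    intro k
    have : catalan k ≤ 4 ^ k := by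
      rw [catalan_eq_centralBinom_div]
      exact (Nat.div_le_self _ _).trans (Nat.centralBinom_le_four_pow k)
    exact_mod_cast this
  have hh : ∀ k, M₀ * κ ^ k * catalan k * 2 ^ (3 * k) ≤ M₀ * K ^ k := by
    intro k
    calc M₀ * κ ^ k * catalan k * 2 ^ (3 * k) ≤ M₀ * κ ^ k * 4 ^ k * 2 ^ (3 * k) := by
          gcongr
          exact hcat k
      _ = M₀ * (32 * κ) ^ k := by
          rw [pow_mul, mul_assoc, mul_assoc, ← mul_pow, ← mul_pow]
          congr 2
          norm_num
          ring
      _ ≤ M₀ * K ^ k := by gcongr; linarith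
  have hD' : ∀ k, ∀ x ∈ U, DerivBound (fderiv ℝ (evolutionCoeff B c f₀ k)) x
      fun n => M₀ * K ^ k * (4 * ρ) ^ n := by
    intro k x hx
    refine (hD k x hx).mono fun n => ?_
    calc M₀ * κ ^ k * catalan k * geomCoeff (2 * ρ) (3 * k) n
        ≤ M₀ * κ ^ k * catalan k * (2 ^ (3 * k) * (2 * (2 * ρ)) ^ n) := by
          gcongr
          exact geomCoeff_le hρ2.le _ _
      _ = M₀ * κ ^ k * catalan k * 2 ^ (3 * k) * (4 * ρ) ^ n := by ring
      _ ≤ _ := mul_le_mul_of_nonneg_right (hh k) (by positivity)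
  -- The bounds so far concern D fₖ only. The size of fₖ itself is read off from the recursion: its
  -- k + 1 terms cancel the division by k + 1.
  have h0 : ∀ k, ∀ x ∈ U, ‖evolutionCoeff B c f₀ k x‖ ≤ (M + M * (‖B‖ * (M₀ * M₀))) * K ^ k := by
    intro k x hx
    have hK1 : 1 ≤ K := by linarith
    rcases k with _ | k
    · have := hfb x hx 0
      simp only [norm_iteratedFDeriv_zero, Nat.factorial_zero, Nat.cast_one, pow_zero, mul_one,
        one_mul] at this
      rw [evolutionCoeff_zero, pow_zero, mul_one]
      have : 0 ≤ M * (‖B‖ * (M₀ * M₀)) := by positivity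
      linarith
    · have hc0 := hcb x hx 0
      simp only [norm_iteratedFDeriv_zero, Nat.factorial_zero, Nat.cast_one, pow_zero, mul_one,
        one_mul] at hc0
      have hd0 : ∀ j, ‖fderiv ℝ (evolutionCoeff B c f₀ j) x‖ ≤ M₀ * K ^ j := by
        intro j
        have := hD' j x hx 0
        simpa using this
      have hS : ‖∑ q ∈ antidiagonal k, B (fderiv ℝ (evolutionCoeff B c f₀ q.1) x)
          (fderiv ℝ (evolutionCoeff B c f₀ q.2) x)‖ ≤ (k + 1) * (‖B‖ * (M₀ * M₀) * K ^ k) := by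
        have : ∀ q ∈ antidiagonal k, ‖B (fderiv ℝ (evolutionCoeff B c f₀ q.1) x)
            (fderiv ℝ (evolutionCoeff B c f₀ q.2) x)‖ ≤ ‖B‖ * (M₀ * M₀) * K ^ k := by
          intro q hq
          refine (B.le_opNorm₂ _ _).trans ?_
          calc _ ≤ ‖B‖ * (M₀ * K ^ q.1) * (M₀ * K ^ q.2) := by
                gcongr
                · exact hd0 _
                · exact hd0 _
            _ = _ := by rw [← Finset.HasAntidiagonal.mem_antidiagonal.1 hq, pow_add]; ring
        refine (norm_sum_le_of_le _ this).trans (le_of_eq ?_)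
        rw [Finset.sum_const, Finset.Nat.card_antidiagonal, nsmul_eq_mul]
        push_cast
        ring
      rw [evolutionCoeff_succ, norm_smul, norm_smul, norm_inv,
        Real.norm_of_nonneg (by positivity : (0 : ℝ) ≤ k + 1), inv_mul_le_iff₀ (by positivity)]
      calc ‖c x‖ * _ ≤ M * ((k + 1) * (‖B‖ * (M₀ * M₀) * K ^ k)) := by gcongr
        _ = (k + 1) * ((M * (‖B‖ * (M₀ * M₀))) * K ^ k) := by ring
        _ ≤ (k + 1) * ((M + M * (‖B‖ * (M₀ * M₀))) * K ^ (k + 1)) := by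
            gcongr
            · linarith
            · exact Nat.le_succ k
  refine ⟨(M + M * (‖B‖ * (M₀ * M₀))) + M₀ / (4 * ρ), K, 4 * ρ, by positivity, by positivity,
    by positivity, fun k x hx => DerivBound.of_fderiv (by positivity) ?_ ?_⟩
  · refine (h0 k x hx).trans ?_
    have : 0 < M₀ / (4 * ρ) := by positivity
    exact mul_le_mul_of_nonneg_right (by linarith) (by positivity)
  · refine (hD' k x hx).mono fun n => ?_
    have : M₀ = M₀ / (4 * ρ) * (4 * ρ) := by field_simp
    calc M₀ * K ^ k * (4 * ρ) ^ n = (0 + M₀ / (4 * ρ)) * K ^ k * (4 * ρ) * (4 * ρ) ^ n := by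
          rw [zero_add, mul_right_comm (M₀ / (4 * ρ)), ← this]
      _ ≤ _ := by gcongr; positivity

end CauchyKovalevskaya

/-! ### Convergence: local existence -/

section CauchyKovalevskaya

set_option maxSynthPendingDepth 3

open Filter
open Finset.HasAntidiagonal (antidiagonal)
open scoped Nat

variable {E F G V : Type*} [NormedAddCommGroup E] [NormedSpace ℝ E]
  [NormedAddCommGroup F] [NormedSpace ℝ F] [NormedAddCommGroup G] [NormedSpace ℝ G]
  [NormedAddCommGroup V] [NormedSpace ℝ V]

theorem DerivBound.comp_clm {f : E → F} {U : Set E} (hU : IsOpen U) (hf : ContDiffOn ℝ ω f U)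
    (L : G →L[ℝ] E) (hL : ‖L‖ ≤ 1) {x : G} (hx : L x ∈ U) {a : ℕ → ℝ}
    (ha : DerivBound f (L x) a) : DerivBound (fun y => f (L y)) x a := by
  intro n
  have hU' : IsOpen (L ⁻¹' U) := hU.preimage L.continuous
  have h := L.iteratedFDerivWithin_comp_right hf hU.uniqueDiffOn hU'.uniqueDiffOn hx
    (i := n) le_top
  rw [iteratedFDerivWithin_of_isOpen _ hU' hx, iteratedFDerivWithin_of_isOpen _ hU hx] at h
  change ‖iteratedFDeriv ℝ n (f ∘ L) x‖ ≤ _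
  rw [h]
  refine (ContinuousMultilinearMap.norm_compContinuousLinearMap_le _ _).trans ?_
  refine (mul_le_of_le_one_right (norm_nonneg _) ?_).trans (ha n)
  exact Finset.prod_le_one (fun _ _ => norm_nonneg _) fun _ _ => hL

/-- Up to the factor sⁿ, the n-th Taylor coefficient of tᵏ is one term of the binomial expansion of
(|t| + 1/s)ᵏ. The free parameter s lets this base be made small. -/
theorem derivBound_pow (k : ℕ) (t : ℝ) {s : ℝ} (hs : 0 < s) :
    DerivBound (fun t : ℝ => t ^ k) t fun n => (|t| + s⁻¹) ^ k * s ^ n := by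
  intro n
  rw [norm_iteratedFDeriv_eq_norm_iteratedDeriv, iteratedDeriv_pow, norm_mul,
    Real.norm_natCast, norm_pow, Real.norm_eq_abs, Nat.descFactorial_eq_factorial_mul_choose,
    Nat.cast_mul, mul_assoc]
  gcongr
  rcases lt_or_ge k n with h | h
  · rw [Nat.choose_eq_zero_of_lt h, Nat.cast_zero, zero_mul]
    positivity
  · have h1 : |t| ^ (k - n) * s⁻¹ ^ n * k.choose n ≤ (|t| + s⁻¹) ^ k := by
      rw [add_comm, add_pow]
      have := Finset.single_le_sum (f := fun m => s⁻¹ ^ m * |t| ^ (k - m) * (k.choose m : ℝ))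
        (s := Finset.range (k + 1)) (fun m _ => by positivity)
        (Finset.mem_range.2 (Nat.lt_succ_of_le h))
      refine le_trans (le_of_eq ?_) this
      ring
    calc (k.choose n : ℝ) * |t| ^ (k - n)
        = (|t| ^ (k - n) * s⁻¹ ^ n * k.choose n) * s ^ n := by
          rw [inv_pow]
          field_simp
      _ ≤ _ := mul_le_mul_of_nonneg_right h1 (by positivity)

variable {B : (E →L[ℝ] V) →L[ℝ] (E →L[ℝ] V) →L[ℝ] V} {c : E → ℝ} {f₀ : E → V} [CompleteSpace V]

/-- A local Cauchy–Kovalevskaya theorem for `∂f/∂t = c • B (Df) (Df)` with `B` bilinear. -/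
theorem exists_analytic_evolution {x₀ : E} (hc : AnalyticAt ℝ c x₀) (hf : AnalyticAt ℝ f₀ x₀) :
    ∃ τ : ℝ, 0 < τ ∧ ∃ U : Set E, IsOpen U ∧ x₀ ∈ U ∧ ∃ Φ : ℝ × E → V,
      AnalyticOnNhd ℝ Φ (Ioo (-τ) τ ×ˢ U) ∧ (∀ x, Φ (0, x) = f₀ x) ∧
      ∀ t ∈ Ioo (-τ) τ, ∀ x ∈ U, HasDerivAt (fun s => Φ (s, x))
        (c x • B (fderiv ℝ (fun y => Φ (t, y)) x) (fderiv ℝ (fun y => Φ (t, y)) x)) t := by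
  obtain ⟨M₁, ρ₁, hM₁, hρ₁, hb₁⟩ := hc.exists_iteratedFDeriv_bound
  obtain ⟨M₂, ρ₂, hM₂, hρ₂, hb₂⟩ := hf.exists_iteratedFDeriv_bound
  obtain ⟨U, hUsub, hU, hxU⟩ := eventually_nhds_iff.1
    (hb₁.and (hb₂.and (hc.eventually_analyticAt.and hf.eventually_analyticAt)))
  have hcU : AnalyticOnNhd ℝ c U := fun x hx => (hUsub x hx).2.2.1
  have hfU : AnalyticOnNhd ℝ f₀ U := fun x hx => (hUsub x hx).2.2.2
  obtain ⟨M, K, ρ', hM, hK, hρ', hbd⟩ := exists_derivBound_evolutionCoeff (B := B) hU hcU hfU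
    (M := M₁ + M₂) (ρ := ρ₁ + ρ₂) (by positivity) (by positivity)
    (fun x hx n => ((hUsub x hx).1 n).trans (by beta_reduce; gcongr <;> linarith))
    (fun x hx n => ((hUsub x hx).2.1 n).trans (by beta_reduce; gcongr <;> linarith))
  set f := evolutionCoeff B c f₀ with hfdef
  -- With ρ ≥ 4K and |t| < τ = 1/(4K), the base |t| + 1/ρ is at most 1/(2K), so the k-th term of the
  -- series gains 2^(-k) against Kᵏ.
  set ρ := ρ' + 4 * K with hρdef
  have hρ : 0 < ρ := by positivity
  set τ := (4 * K)⁻¹ with hτ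
  have hτ0 : 0 < τ := by positivity
  set g : ℕ → ℝ × E → V := fun k z => z.1 ^ k • f k z.2 with hg
  set W : Set (ℝ × E) := Ioo (-τ) τ ×ˢ U with hW
  have hWo : IsOpen W := isOpen_Ioo.prod hU
  have hfan : ∀ k, AnalyticOnNhd ℝ (f k) U := analyticOnNhd_evolutionCoeff hcU hfU
  have hfan' : ∀ k, AnalyticOnNhd ℝ (fun z : ℝ × E => f k z.2) W := fun k z hz =>
    AnalyticAt.fun_comp (hfan k z.2 hz.2) analyticAt_snd
  have hpow : ∀ k : ℕ, AnalyticOnNhd ℝ (fun z : ℝ × E => z.1 ^ k) W := fun k z _ =>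
    analyticAt_fst.pow k
  have hgan : ∀ k, AnalyticOnNhd ℝ (g k) W := fun k => (hpow k).smul (hfan' k)
  have hgb : ∀ k n, ∀ z ∈ W, ‖iteratedFDeriv ℝ n (g k) z‖ ≤
      n ! * (2 * M * (1 / 2) ^ k * (2 * ρ) ^ n) := by
    intro k n z hz
    have h1 : DerivBound (fun z : ℝ × E => z.1 ^ k) z
        fun n => (|z.1| + ρ⁻¹) ^ k * geomCoeff ρ 0 n := by
      simp only [geomCoeff_zero]
      have hid : ContDiff ℝ ω fun t : ℝ => t ^ k := contDiff_id.pow k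
      exact (derivBound_pow k z.1 hρ).comp_clm isOpen_univ hid.contDiffOn
        (ContinuousLinearMap.fst ℝ ℝ E) (ContinuousLinearMap.norm_fst_le ℝ ℝ E) (mem_univ _)
    have h2 : DerivBound (fun z : ℝ × E => f k z.2) z fun n => M * K ^ k * geomCoeff ρ 0 n := by
      refine DerivBound.mono (a := fun n => M * K ^ k * ρ' ^ n) ?_ fun n => ?_
      · exact (hbd k z.2 hz.2).comp_clm hU ((hfan k).contDiffOn hU.uniqueDiffOn)
          (ContinuousLinearMap.snd ℝ ℝ E) (ContinuousLinearMap.norm_snd_le ℝ ℝ E) hz.2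
      · rw [geomCoeff_zero]
        gcongr
        linarith
    have h3 := h1.bilinear_geomCoeff (ContinuousLinearMap.lsmul ℝ ℝ : ℝ →L[ℝ] V →L[ℝ] V) hWo
      ((hpow k).contDiffOn hWo.uniqueDiffOn) ((hfan' k).contDiffOn hWo.uniqueDiffOn) hz h2
    refine (h3 n).trans (mul_le_mul_of_nonneg_left ?_ (by positivity))
    have ht : |z.1| + ρ⁻¹ ≤ (2 * K)⁻¹ := by
      have h4 : |z.1| ≤ (4 * K)⁻¹ := (abs_lt.2 hz.1).le
      have h5 : ρ⁻¹ ≤ (4 * K)⁻¹ := by gcongr; linarith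
      calc |z.1| + ρ⁻¹ ≤ (4 * K)⁻¹ + (4 * K)⁻¹ := add_le_add h4 h5
        _ = (2 * K)⁻¹ := by field_simp; norm_num
    have h6 : (|z.1| + ρ⁻¹) ^ k * (M * K ^ k) ≤ M * (1 / 2) ^ k := by
      calc (|z.1| + ρ⁻¹) ^ k * (M * K ^ k) ≤ (2 * K)⁻¹ ^ k * (M * K ^ k) := by gcongr
        _ = M * ((2 * K)⁻¹ * K) ^ k := by rw [mul_pow]; ring
        _ = _ := by congr 2; field_simp
    calc _ ≤ (1 * (M * (1 / 2) ^ k)) * (2 ^ 1 * (2 * ρ) ^ n) := by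
          refine mul_le_mul (mul_le_mul ContinuousLinearMap.opNorm_lsmul_le h6 (by positivity)
            zero_le_one) (geomCoeff_le hρ.le _ _) (geomCoeff_nonneg hρ.le _ _) (by positivity)
      _ = _ := by ring
  obtain ⟨han, hder⟩ := AnalyticOnNhd.tsum_of_iteratedFDeriv_bound hWo hgan
    (by positivity : (0 : ℝ) ≤ 2 * M) (by positivity : 0 < 2 * ρ) (by norm_num : (0 : ℝ) ≤ 1 / 2)
    (by norm_num) hgb
  refine ⟨τ, hτ0, U, hU, hxU, fun z => ∑' k, g k z, han, fun x => ?_, fun t ht x hx => ?_⟩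
  · beta_reduce
    rw [tsum_eq_single 0 fun k hk => by simp [hg, hk]]
    simp [hg, hfdef, evolutionCoeff_zero]
  have hz : ((t, x) : ℝ × E) ∈ W := ⟨ht, hx⟩
  have hD := hder (t, x) hz
  have hsumD : Summable fun k => fderiv ℝ (g k) (t, x) := by
    refine Summable.of_norm_bounded (g := fun k => 2 * M * (2 * ρ) * (1 / 2) ^ k)
      ((summable_geometric_of_lt_one (by norm_num) (by norm_num)).mul_left _) fun k => ?_
    have := hgb k 1 (t, x) hz
    rw [norm_iteratedFDeriv_one] at this
    refine this.trans (le_of_eq ?_)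
    simp only [Nat.factorial_one, Nat.cast_one, pow_one]
    ring
  have hgD : ∀ k, HasFDerivAt (g k) (fderiv ℝ (g k) (t, x)) (t, x) := fun k =>
    (hgan k _ hz).differentiableAt.hasFDerivAt
  have hincl : ∀ {Ψ : ℝ × E → V} {Ψ' : ℝ × E →L[ℝ] V}, HasFDerivAt Ψ Ψ' (t, x) →
      HasFDerivAt (fun y => Ψ (t, y)) (Ψ'.comp (ContinuousLinearMap.inr ℝ ℝ E)) x := fun h =>
    HasFDerivAt.comp x h (hasFDerivAt_prodMk_right t x)
  have hinclt : ∀ {Ψ : ℝ × E → V} {Ψ' : ℝ × E →L[ℝ] V}, HasFDerivAt Ψ Ψ' (t, x) →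
      HasDerivAt (fun s => Ψ (s, x)) (Ψ' (1, 0)) t := fun {Ψ Ψ'} h => by
    have := (HasFDerivAt.comp t h (hasFDerivAt_prodMk_left t x)).hasDerivAt
    simpa [Function.comp_def] using this
  have hspace : ∀ k, (fderiv ℝ (g k) (t, x)).comp (ContinuousLinearMap.inr ℝ ℝ E)
      = t ^ k • fderiv ℝ (f k) x := fun k =>
    (hincl (hgD k)).unique ((hfan k x hx).differentiableAt.hasFDerivAt.const_smul (t ^ k))
  have htime : ∀ k, fderiv ℝ (g k) (t, x) (1, 0) = ((k : ℝ) * t ^ (k - 1)) • f k x := fun k =>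
    (hinclt (hgD k)).unique ((hasDerivAt_pow k t).smul_const (f k x))
  have hsp : HasSum (fun k => t ^ k • fderiv ℝ (f k) x)
      (fderiv ℝ (fun y => ∑' k, g k (t, y)) x) := by
    rw [(hincl hD).fderiv]
    have := ((ContinuousLinearMap.compL ℝ E (ℝ × E) V).flip
      (ContinuousLinearMap.inr ℝ ℝ E)).hasSum hsumD.hasSum
    simpa only [ContinuousLinearMap.flip_apply, ContinuousLinearMap.compL_apply, hspace] using this
  have hspn : Summable fun k => ‖t ^ k • fderiv ℝ (f k) x‖ := by
    refine Summable.of_nonneg_of_le (fun _ => norm_nonneg _) (fun k => ?_)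
      ((summable_geometric_of_lt_one (r := 1 / 2) (by norm_num) (by norm_num)).mul_left
        (2 * M * (2 * ρ)))
    rw [← hspace]
    have := hgb k 1 (t, x) hz
    rw [norm_iteratedFDeriv_one] at this
    refine ((ContinuousLinearMap.opNorm_comp_le _ _).trans
      (mul_le_of_le_one_right (norm_nonneg _) (ContinuousLinearMap.norm_inr_le_one ℝ ℝ E))).trans
      (this.trans (le_of_eq ?_))
    simp only [Nat.factorial_one, Nat.cast_one, pow_one]
    ring
  have htm : HasSum (fun k : ℕ => ((k : ℝ) * t ^ (k - 1)) • f k x)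
      ((∑' k, fderiv ℝ (g k) (t, x)) (1, 0)) := by
    have := (ContinuousLinearMap.apply ℝ V ((1, 0) : ℝ × E)).hasSum hsumD.hasSum
    simpa only [ContinuousLinearMap.apply_apply, htime] using this
  convert! hinclt hD using 1
  have hprod := (B.hasSum_antidiagonal_of_summable_norm hspn hspn).const_smul (c x)
  rw [hsp.tsum_eq] at hprod
  -- The constant term drops out of the time derivative; after this shift its k-th term is (k+1) tᵏ
  -- f_{k+1}, which the recursion equates with the k-th term of the Cauchy product.
  have htm' := (hasSum_nat_add_iff' 1).2 htm
  simp only [Finset.range_one, Finset.sum_singleton, Nat.cast_zero, zero_mul, zero_smul, sub_zero,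
    Nat.add_sub_cancel] at htm'
  refine hprod.unique ?_
  convert! htm' using 1
  funext k
  rw [hfdef, evolutionCoeff_succ, smul_smul, Finset.smul_sum, Finset.smul_sum, Finset.smul_sum]
  refine Finset.sum_congr rfl fun q hq => ?_
  rw [map_smul, map_smul, smul_apply, smul_smul, smul_smul, smul_smul,
    ← Finset.HasAntidiagonal.mem_antidiagonal.1 hq, pow_add]
  congr 1
  push_cast
  field_simp

end CauchyKovalevskaya

/-! ### Uniqueness of analytic solutions -/

section CauchyKovalevskayaUniqueness

set_option maxSynthPendingDepth 3

open Filter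

variable {E V : Type*} [NormedAddCommGroup E] [NormedSpace ℝ E]
  [NormedAddCommGroup V] [NormedSpace ℝ V] [CompleteSpace V]

/-- A bilinear expression vanishes to the order to which its second argument does. -/
theorem iteratedFDeriv_bilinear_eq_zero {D F G H : Type*} [NormedAddCommGroup D] [NormedSpace ℝ D]
    [NormedAddCommGroup F] [NormedSpace ℝ F] [NormedAddCommGroup G] [NormedSpace ℝ G]
    [NormedAddCommGroup H] [NormedSpace ℝ H] (B : F →L[ℝ] G →L[ℝ] H) {f : D → F} {g : D → G}
    {U : Set D} (hU : IsOpen U) (hf : ContDiffOn ℝ ω f U) (hg : ContDiffOn ℝ ω g U) {x : D}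
    (hx : x ∈ U) {n : ℕ} (h0 : ∀ j ≤ n, iteratedFDeriv ℝ j g x = 0) :
    iteratedFDeriv ℝ n (fun y => B (f y) (g y)) x = 0 := by
  have h := B.norm_iteratedFDerivWithin_le_of_bilinear hf hg hU.uniqueDiffOn hx (n := n) le_top
  simp only [iteratedFDerivWithin_of_isOpen _ hU hx] at h
  refine norm_le_zero_iff.1 (h.trans (le_of_eq ?_))
  rw [Finset.sum_eq_zero, mul_zero]
  intro i _
  rw [h0 _ (Nat.sub_le n i), norm_zero, mul_zero]

/-- The spatial derivative of a function that vanishes to order `n` along `t = 0` vanishes to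
order `n` there. -/
theorem iteratedFDeriv_spatial_fderiv_eq_zero {τ : ℝ} {U : Set E} (hτ : 0 < τ) (hU : IsOpen U)
    {h : ℝ × E → V} (hh : AnalyticOnNhd ℝ h (Ioo (-τ) τ ×ˢ U)) {n : ℕ}
    (h0 : ∀ x ∈ U, iteratedFDeriv ℝ n h (0, x) = 0) {x : E} (hx : x ∈ U) :
    iteratedFDeriv ℝ n (fun z => (fderiv ℝ h z).comp (ContinuousLinearMap.inr ℝ ℝ E)) (0, x)
      = 0 := by
  have hz : ((0, x) : ℝ × E) ∈ Ioo (-τ) τ ×ˢ U := ⟨⟨by simpa using hτ, hτ⟩, hx⟩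
  have hat := hh _ hz
  set R := (ContinuousLinearMap.compL ℝ E (ℝ × E) V).flip (ContinuousLinearMap.inr ℝ ℝ E) with hR
  change iteratedFDeriv ℝ n (R ∘ fderiv ℝ h) (0, x) = 0
  rw [R.iteratedFDeriv_comp_left (hat.fderiv.contDiffAt (n := ω)) le_top]
  ext v ξ
  simp only [ContinuousLinearMap.compContinuousMultilinearMap_coe, Function.comp_apply, hR,
    ContinuousLinearMap.flip_apply, ContinuousLinearMap.compL_apply,
    ContinuousLinearMap.comp_apply, ContinuousLinearMap.inr_apply,
    zero_apply]
  -- By symmetry of the derivative the spatial direction moves to the outermost slot, where it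
  -- differentiates Dⁿh along t = 0, on which Dⁿh vanishes.
  set m : Fin (n + 1) → ℝ × E := Fin.snoc v (0, ξ) with hm
  have h1 := iteratedFDeriv_succ_apply_right (𝕜 := ℝ) (f := h) (x := (0, x)) m
  rw [hm, Fin.init_snoc, Fin.snoc_last, ← hm] at h1
  rw [← h1, ← hat.contDiffAt.iteratedFDeriv_comp_perm m (Equiv.swap 0 (Fin.last n)),
    iteratedFDeriv_succ_apply_left]
  have h2 : (m ∘ Equiv.swap 0 (Fin.last n)) 0 = (0, ξ) := by simp [hm]
  rw [h2]
  have h3 : DifferentiableAt ℝ (iteratedFDeriv ℝ n h) (0, x) :=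
    (hh.iteratedFDeriv_of_isOpen (isOpen_Ioo.prod hU) n _ hz).differentiableAt
  have h4 := HasFDerivAt.comp x h3.hasFDerivAt (hasFDerivAt_prodMk_right (0 : ℝ) x)
  have h5 : (iteratedFDeriv ℝ n h ∘ fun y => ((0 : ℝ), y)) =ᶠ[𝓝 x] fun _ => 0 := by
    filter_upwards [hU.mem_nhds hx] with y hy using h0 y hy
  have h6 := h4.unique ((hasFDerivAt_const 0 x).congr_of_eventuallyEq h5)
  have h7 := congrArg (fun L => L ξ) h6
  simp only [ContinuousLinearMap.comp_apply, ContinuousLinearMap.inr_apply,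
    zero_apply] at h7
  rw [h7, zero_apply]

/-- Analytic solutions of a linear first-order equation `∂h/∂t = A (D_x h)` with zero initial
value vanish. -/
theorem eqOn_zero_of_linear_evolution {τ : ℝ} {U : Set E} (hU : IsOpen U)
    {h : ℝ × E → V} (hh : AnalyticOnNhd ℝ h (Ioo (-τ) τ ×ˢ U))
    {A : ℝ × E → (E →L[ℝ] V) →L[ℝ] V} (hA : AnalyticOnNhd ℝ A (Ioo (-τ) τ ×ˢ U))
    (h0 : ∀ x ∈ U, h (0, x) = 0)
    (hev : ∀ z ∈ Ioo (-τ) τ ×ˢ U, fderiv ℝ h z (1, 0)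
      = A z ((fderiv ℝ h z).comp (ContinuousLinearMap.inr ℝ ℝ E))) :
    ∀ z ∈ Ioo (-τ) τ ×ˢ U, h z = 0 := by
  rintro ⟨t, x⟩ ⟨ht, hx⟩
  have hτ : 0 < τ := by have := ht.1.trans ht.2; linarith
  set W : Set (ℝ × E) := Ioo (-τ) τ ×ˢ U with hW
  have hWo : IsOpen W := isOpen_Ioo.prod hU
  have hmem : ∀ x ∈ U, ((0, x) : ℝ × E) ∈ W := fun x hx => ⟨⟨by simpa using hτ, hτ⟩, hx⟩
  set R := (ContinuousLinearMap.compL ℝ E (ℝ × E) V).flip (ContinuousLinearMap.inr ℝ ℝ E) with hR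
  set Q : ℝ × E → E →L[ℝ] V := fun z => (fderiv ℝ h z).comp (ContinuousLinearMap.inr ℝ ℝ E)
    with hQ
  have hQan : AnalyticOnNhd ℝ Q W := fun z hz =>
    (R.analyticAt _).comp (hh z hz).fderiv
  set S : V →L[ℝ] (ℝ × E →L[ℝ] V) :=
    ContinuousLinearMap.smulRightL ℝ (ℝ × E) V (ContinuousLinearMap.fst ℝ ℝ E) with hS
  set T : (E →L[ℝ] V) →L[ℝ] (ℝ × E →L[ℝ] V) :=
    (ContinuousLinearMap.compL ℝ (ℝ × E) E V).flip (ContinuousLinearMap.snd ℝ ℝ E) with hT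
  -- The equation expresses the full derivative through the spatial one, Q.
  have hdecomp : ∀ z ∈ W, fderiv ℝ h z = S (A z (Q z)) + T (Q z) := by
    intro z hz
    ext v
    · simp [hS, hT, hQ, ← hev z hz]
      exact (fderiv ℝ h z).map_zero
    · simp [hS, hT, hQ]
  -- Vanishing of the derivatives of h up to order n on t = 0 passes to Q, hence to the right side
  -- of `hdecomp`, which gives order n + 1.
  have key : ∀ n, ∀ x ∈ U, iteratedFDeriv ℝ n h (0, x) = 0 := by
    intro n
    induction n using Nat.strong_induction_on with
    | _ n ih =>
      intro x hx
      rcases n with _ | n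
      · ext v
        simp [h0 x hx]
      · have hz := hmem x hx
        have hQ0 : ∀ j ≤ n, iteratedFDeriv ℝ j Q (0, x) = 0 := fun j hj =>
          iteratedFDeriv_spatial_fderiv_eq_zero hτ hU hh (ih j (Nat.lt_succ_of_le hj)) hx
        have hAQ : iteratedFDeriv ℝ n (fun z => A z (Q z)) (0, x) = 0 :=
          iteratedFDeriv_bilinear_eq_zero (ContinuousLinearMap.id ℝ _) hWo
            (hA.contDiffOn hWo.uniqueDiffOn) (hQan.contDiffOn hWo.uniqueDiffOn) hz hQ0
        have hAQan : AnalyticAt ℝ (fun z => A z (Q z)) (0, x) := 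
          ((ContinuousLinearMap.id ℝ ((E →L[ℝ] V) →L[ℝ] V)).analyticAt_bilinear _).comp₂
            (hA _ hz) (hQan _ hz)
        have heq : fderiv ℝ h =ᶠ[𝓝 (0, x)] (S ∘ fun z => A z (Q z)) + T ∘ Q := by
          filter_upwards [hWo.mem_nhds hz] with z hz using hdecomp z hz
        rw [← norm_eq_zero, ← norm_iteratedFDeriv_fderiv, (heq.iteratedFDeriv ℝ n).eq_of_nhds,
          iteratedFDeriv_add_apply (((S.analyticAt _).comp hAQan).contDiffAt)
            (((T.analyticAt _).comp (hQan _ hz)).contDiffAt),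
          S.iteratedFDeriv_comp_left (hAQan.contDiffAt (n := ω)) le_top,
          T.iteratedFDeriv_comp_left ((hQan _ hz).contDiffAt (n := ω)) le_top, hAQ, hQ0 n le_rfl]
        rw [norm_eq_zero]
        refine ContinuousMultilinearMap.ext fun v => ?_
        simp only [add_apply, ContinuousLinearMap.compContinuousMultilinearMap_coe,
          Function.comp_apply, zero_apply, map_zero, add_zero]
  have hev0 : h =ᶠ[𝓝 (0, x)] 0 := by
    obtain ⟨p, r, hp⟩ := hh _ (hmem x hx)
    filter_upwards [Metric.eball_mem_nhds _ hp.r_pos] with z hz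
    have hy : z - (0, x) ∈ Metric.eball (0 : ℝ × E) r := by
      simpa [Metric.mem_eball, edist_eq_enorm_sub] using hz
    have := hp.hasSum_iteratedFDeriv hy
    rw [add_sub_cancel] at this
    refine this.unique ?_
    simp only [key _ x hx, zero_apply, smul_zero]
    exact hasSum_zero
  -- Continuation runs along the time interval at fixed x, so U need not be connected.
  have hline : AnalyticOnNhd ℝ (fun s => h (s, x)) (Ioo (-τ) τ) := fun s hs =>
    AnalyticAt.fun_comp (hh (s, x) ⟨hs, hx⟩) (analyticAt_id.prod analyticAt_const)
  have hcont : Tendsto (fun s : ℝ => (s, x)) (𝓝 0) (𝓝 (0, x)) :=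
    (Continuous.prodMk_left x).tendsto 0
  exact hline.eqOn_zero_of_preconnected_of_eventuallyEq_zero isPreconnected_Ioo
    (hmem x hx).1 (hcont.eventually hev0) ht

/-- Uniqueness of analytic solutions of `∂f/∂t = c • B (D_x f) (D_x f)`. -/
theorem analytic_evolution_unique {B : (E →L[ℝ] V) →L[ℝ] (E →L[ℝ] V) →L[ℝ] V} {c : E → ℝ} {τ : ℝ}
    {U : Set E} (hU : IsOpen U) (hc : AnalyticOnNhd ℝ c U) {Φ Φ' : ℝ × E → V}
    (hΦ : AnalyticOnNhd ℝ Φ (Ioo (-τ) τ ×ˢ U)) (hΦ' : AnalyticOnNhd ℝ Φ' (Ioo (-τ) τ ×ˢ U))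
    (h0 : ∀ x ∈ U, Φ (0, x) = Φ' (0, x))
    (hev : ∀ t ∈ Ioo (-τ) τ, ∀ x ∈ U, HasDerivAt (fun s => Φ (s, x))
        (c x • B (fderiv ℝ (fun y => Φ (t, y)) x) (fderiv ℝ (fun y => Φ (t, y)) x)) t)
    (hev' : ∀ t ∈ Ioo (-τ) τ, ∀ x ∈ U, HasDerivAt (fun s => Φ' (s, x))
        (c x • B (fderiv ℝ (fun y => Φ' (t, y)) x) (fderiv ℝ (fun y => Φ' (t, y)) x)) t) :
    ∀ t ∈ Ioo (-τ) τ, ∀ x ∈ U, Φ (t, x) = Φ' (t, x) := by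
  set W : Set (ℝ × E) := Ioo (-τ) τ ×ˢ U with hW
  set R := (ContinuousLinearMap.compL ℝ E (ℝ × E) V).flip (ContinuousLinearMap.inr ℝ ℝ E) with hR
  have hQan : ∀ {f : ℝ × E → V}, AnalyticOnNhd ℝ f W →
      AnalyticOnNhd ℝ (fun z => R (fderiv ℝ f z)) W := fun hf z hz =>
    (R.analyticAt _).comp (hf z hz).fderiv
  -- From B(a, a) - B(a', a') = B(a - a', a) + B(a', a - a'), valid without symmetry of B.
  set A : ℝ × E → (E →L[ℝ] V) →L[ℝ] V := fun z =>
    c z.2 • (B.flip (R (fderiv ℝ Φ z)) + B (R (fderiv ℝ Φ' z))) with hA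
  have hAan : AnalyticOnNhd ℝ A W := fun z hz => by
    refine AnalyticAt.smul (AnalyticAt.fun_comp (hc z.2 hz.2) analyticAt_snd) (AnalyticAt.add ?_ ?_)
    · exact (B.flip.analyticAt _).comp (hQan hΦ z hz)
    · exact (B.analyticAt _).comp (hQan hΦ' z hz)
  have hlift : ∀ {f : ℝ × E → V}, AnalyticOnNhd ℝ f W → (∀ t ∈ Ioo (-τ) τ, ∀ x ∈ U,
      HasDerivAt (fun s => f (s, x))
        (c x • B (fderiv ℝ (fun y => f (t, y)) x) (fderiv ℝ (fun y => f (t, y)) x)) t) →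
      ∀ z ∈ W, fderiv ℝ f z (1, 0)
        = c z.2 • B (R (fderiv ℝ f z)) (R (fderiv ℝ f z)) := by
    rintro f hf hfev ⟨t, x⟩ hz
    have hd := (hf _ hz).differentiableAt.hasFDerivAt
    have h1 := (HasFDerivAt.comp x hd (hasFDerivAt_prodMk_right t x)).fderiv
    have h2 := (HasFDerivAt.comp t hd (hasFDerivAt_prodMk_left t x)).hasDerivAt
    have h3 := h2.unique (hfev t hz.1 x hz.2)
    simp only [Function.comp_def] at h1
    rw [h1] at h3
    simpa [hR] using h3
  have hzero := eqOn_zero_of_linear_evolution (h := fun z => Φ z - Φ' z) hU (hΦ.sub hΦ') hAan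
    (fun x hx => sub_eq_zero.2 (h0 x hx)) fun z hz => by
      have hsub : fderiv ℝ (fun z => Φ z - Φ' z) z = fderiv ℝ Φ z - fderiv ℝ Φ' z :=
        fderiv_fun_sub (hΦ z hz).differentiableAt (hΦ' z hz).differentiableAt
      have hR' : ∀ L : ℝ × E →L[ℝ] V, L.comp (ContinuousLinearMap.inr ℝ ℝ E) = R L := fun L => rfl
      rw [hsub, sub_apply, hlift hΦ hev z hz, hlift hΦ' hev' z hz, hR', map_sub, hA]
      simp only [smul_apply, add_apply, ContinuousLinearMap.flip_apply, map_sub]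
      rw [← smul_sub, ← smul_sub]
      congr 1
      abel
  intro t ht x hx
  exact sub_eq_zero.1 (hzero (t, x) ⟨ht, hx⟩)

end CauchyKovalevskayaUniqueness

/-! ### The cross product of ℝ⁷ and associative planes -/

section CrossProduct

open exteriorPower

theorem update_vecCons_zero {α : Type*} (a b x : α) : Function.update ![a, b] 0 x = ![x, b] := by
  funext i
  fin_cases i <;> simp

theorem update_vecCons_one {α : Type*} (a b x : α) : Function.update ![a, b] 1 x = ![a, x] := by
  funext i
  fin_cases i <;> simp

/-- The cross product on `ℝ⁷` determined by the associative 3-form. -/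
noncomputable def crossPhi : R7 →L[ℝ] R7 →L[ℝ] R7 :=
  LinearMap.toContinuousBilinearMap <|
    LinearMap.mk₂ ℝ (fun u v => contractPhi (ιMulti ℝ 2 ![u, v]))
      (fun u u' v => by
        rw [← map_add]
        congr 1
        simpa only [update_vecCons_zero, update_vecCons_one] using
          (ιMulti ℝ 2 (M := R7)).map_update_add ![u, v] 0 u u')
      (fun a u v => by
        rw [← map_smul]
        congr 1
        simpa only [update_vecCons_zero, update_vecCons_one] using
          (ιMulti ℝ 2 (M := R7)).map_update_smul ![u, v] 0 a u)
      (fun u v v' => by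
        rw [← map_add]
        congr 1
        simpa only [update_vecCons_zero, update_vecCons_one] using
          (ιMulti ℝ 2 (M := R7)).map_update_add ![u, v] 1 v v')
      (fun a u v => by
        rw [← map_smul]
        congr 1
        simpa only [update_vecCons_zero, update_vecCons_one] using
          (ιMulti ℝ 2 (M := R7)).map_update_smul ![u, v] 1 a v)

theorem contractPhi_ιMulti (u v : R7) : contractPhi (ιMulti ℝ 2 ![u, v]) = crossPhi u v := rfl

theorem phi_apply (u v w : R7) : phi ![u, v, w] =
    (Matrix.of ![![u 0, u 1, u 2], ![v 0, v 1, v 2], ![w 0, w 1, w 2]]).det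
    + (Matrix.of ![![u 0, u 3, u 4], ![v 0, v 3, v 4], ![w 0, w 3, w 4]]).det
    + (Matrix.of ![![u 0, u 5, u 6], ![v 0, v 5, v 6], ![w 0, w 5, w 6]]).det
    + (Matrix.of ![![u 1, u 3, u 5], ![v 1, v 3, v 5], ![w 1, w 3, w 5]]).det
    - (Matrix.of ![![u 1, u 4, u 6], ![v 1, v 4, v 6], ![w 1, w 4, w 6]]).det
    - (Matrix.of ![![u 2, u 3, u 6], ![v 2, v 3, v 6], ![w 2, w 3, w 6]]).det
    - (Matrix.of ![![u 2, u 4, u 5], ![v 2, v 4, v 5], ![w 2, w 4, w 5]]).det := by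
  have h : ∀ i j k : Fin 7, dx3 i j k ![u, v, w] =
      (Matrix.of ![![u i, u j, u k], ![v i, v j, v k], ![w i, w j, w k]]).det := by
    intro i j k
    rw [dx3, AlternatingMap.compLinearMap_apply]
    change Matrix.det _ = _
    congr 1
    ext a b
    fin_cases a <;> fin_cases b <;> rfl
  simp only [phi, AlternatingMap.add_apply, AlternatingMap.sub_apply, h]

theorem crossPhi_apply (u v : R7) (d : Fin 7) :
    crossPhi u v d = phi ![EuclideanSpace.single d 1, u, v] := by
  rw [← contractPhi_ιMulti, contractPhi, alternatingMapLinearEquiv_apply_ιMulti]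
  simp only [Fin.sum_univ_seven, AlternatingMap.add_apply, LinearMap.compAlternatingMap_apply,
    LinearMap.toSpanSingleton_apply, AlternatingMap.curryLeft_apply_apply]
  fin_cases d <;> simp

theorem inner_crossPhi (u v w : R7) : inner ℝ (crossPhi u v) w = phi ![u, v, w] := by
  simp only [PiLp.inner_apply, crossPhi_apply, phi_apply, Fin.sum_univ_seven, Matrix.det_fin_three]
  simp
  ring

/-- A polynomial identity in coordinates. It is special to this φ, and it is what makes φ a
calibration with the right normalisation. -/
theorem norm_sq_crossPhi (u v : R7) :
    ‖crossPhi u v‖ ^ 2 = ‖u‖ ^ 2 * ‖v‖ ^ 2 - inner ℝ u v ^ 2 := by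
  simp only [EuclideanSpace.norm_sq_eq, PiLp.inner_apply, crossPhi_apply, phi_apply,
    Fin.sum_univ_seven, Matrix.det_fin_three]
  simp
  ring

theorem crossPhi_self (u : R7) : crossPhi u u = 0 := by
  have h := norm_sq_crossPhi u u
  rw [real_inner_self_eq_norm_sq, ← sq (‖u‖ ^ 2), sub_self] at h
  exact norm_eq_zero.1 (pow_eq_zero_iff two_ne_zero |>.1 h)

theorem inner_crossPhi_left (u v : R7) : inner ℝ (crossPhi u v) u = 0 := by
  rw [inner_crossPhi]
  exact phi.map_eq_zero_of_eq _ (by simp : ![u, v, u] 0 = ![u, v, u] 2) (by decide)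

theorem inner_crossPhi_right (u v : R7) : inner ℝ (crossPhi u v) v = 0 := by
  rw [inner_crossPhi]
  exact phi.map_eq_zero_of_eq _ (by simp : ![u, v, v] 1 = ![u, v, v] 2) (by decide)

/-- An oriented 3-plane on which `φ` is positive and which contains the cross product of two of its
linearly independent vectors is associative. -/
theorem isAssociativePlane_of_crossPhi_mem {V : Submodule ℝ R7} (hV : Module.finrank ℝ V = 3)
    {u v : R7} (hu : u ∈ V) (hv : v ∈ V) (hw : crossPhi u v ∈ V) (hne : crossPhi u v ≠ 0)
    {o : Orientation ℝ V (Fin 3)} (hφ : phi.compLinearMap V.subtype ≠ 0)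
    (ho : o = rayOfNeZero ℝ _ hφ) : IsAssociativePlane V o := by
  refine ⟨hV, ?_⟩
  have : Fact (Module.finrank ℝ V = 3) := ⟨hV⟩
  set b := o.finOrthonormalBasis (by norm_num) hV with hb
  have hvol := o.volumeForm_robust b (o.finOrthonormalBasis_orientation (by norm_num) hV)
  have hbo : b.toBasis.orientation = o := o.finOrthonormalBasis_orientation (by norm_num) hV
  have hray : SameRay ℝ (phi.compLinearMap V.subtype) o.volumeForm := by
    rw [hvol]
    rw [ho, Module.Basis.orientation] at hbo
    exact ((ray_eq_iff _ _).1 hbo).symm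
  obtain ⟨c, hc, hcv⟩ := hray.exists_pos_right hφ (by rw [hvol]; exact b.toBasis.det_ne_zero)
  have hu0 : u ≠ 0 := by rintro rfl; simp at hne
  -- On V, φ is c · vol with c > 0. Making v orthogonal to u leaves u × v unchanged, and on the
  -- orthogonal triple u, v', u × v both φ and |vol| equal |u × v|²; hence c = 1.
  set s : ℝ := inner ℝ u v / ‖u‖ ^ 2 with hs
  set v' := v - s • u with hv'
  have hcross : crossPhi u v' = crossPhi u v := by
    rw [hv', map_sub, map_smul, crossPhi_self, smul_zero, sub_zero]
  have hv'V : v' ∈ V := V.sub_mem hv (V.smul_mem s hu)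
  have huv' : inner ℝ u v' = 0 := by
    rw [hv', inner_sub_right, inner_smul_right, real_inner_self_eq_norm_sq, hs]
    have : ‖u‖ ≠ 0 := norm_ne_zero_iff.2 hu0
    field_simp
    ring
  have hnorm : ‖crossPhi u v‖ = ‖u‖ * ‖v'‖ := by
    have h := norm_sq_crossPhi u v'
    rw [huv', hcross] at h
    refine (sq_eq_sq₀ (norm_nonneg _) (by positivity)).1 ?_
    rw [h]
    ring
  set x : Fin 3 → V := ![⟨u, hu⟩, ⟨v', hv'V⟩, ⟨crossPhi u v, hw⟩] with hx
  have horth : Pairwise fun i j => inner ℝ (x i) (x j) = 0 := by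
    have h1 : inner ℝ v' (crossPhi u v) = 0 := by
      rw [real_inner_comm, ← hcross]; exact inner_crossPhi_right u v'
    have h2 : inner ℝ u (crossPhi u v) = 0 := by
      rw [real_inner_comm]; exact inner_crossPhi_left u v
    intro i j hij
    rw [Submodule.coe_inner]
    fin_cases i <;> fin_cases j <;>
      first
      | exact absurd rfl hij
      | exact huv'
      | exact h1
      | exact h2
      | (rw [real_inner_comm]; exact huv')
      | (rw [real_inner_comm]; exact h1)
      | (rw [real_inner_comm]; exact h2)
  have habs := o.abs_volumeForm_apply_of_pairwise_orthogonal horth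
  have hprod : ∏ i, ‖x i‖ = ‖crossPhi u v‖ ^ 2 := by
    rw [Fin.prod_univ_three]
    change ‖u‖ * ‖v'‖ * ‖crossPhi u v‖ = _
    rw [← hnorm, sq]
  have hval : phi.compLinearMap V.subtype x = ‖crossPhi u v‖ ^ 2 := by
    have : (fun i => V.subtype (x i)) = ![u, v', crossPhi u v] := by
      funext i; fin_cases i <;> rfl
    rw [AlternatingMap.compLinearMap_apply, this, ← inner_crossPhi, hcross,
      real_inner_self_eq_norm_sq]
  have hcv' := congrArg (fun f => f x) hcv
  simp only [AlternatingMap.smul_apply, smul_eq_mul] at hcv'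
  have hpos : 0 < ‖crossPhi u v‖ ^ 2 := by
    have := norm_pos_iff.2 hne
    positivity
  have hc1 : c = 1 := by
    have h1 := congrArg abs hcv'
    rw [abs_mul, abs_of_pos hc, habs, hprod, hval, abs_of_pos hpos] at h1
    have : (c - 1) * ‖crossPhi u v‖ ^ 2 = 0 := by linarith
    rcases mul_eq_zero.1 this with h | h
    · linarith
    · exact absurd h hpos.ne'
  rw [hcv, hc1, one_smul]

end CrossProduct

/-! ### Bivectors of a plane -/

section Bivectors

open exteriorPower

variable {M : Type*} [AddCommGroup M] [Module ℝ M]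

/-- The coordinate of a bivector of a plane with respect to `e 0 ∧ e 1`. -/
noncomputable def bivectorCoord (e : Module.Basis (Fin 2) ℝ M) : ⋀[ℝ]^2 M →ₗ[ℝ] ℝ :=
  alternatingMapLinearEquiv e.det

/-- Alternating maps are determined on distinct basis vectors; for a plane these are permutations of
e, and both sides acquire the same sign. -/
theorem bivectorCoord_smul_ιMulti (e : Module.Basis (Fin 2) ℝ M) (W : ⋀[ℝ]^2 M) :
    bivectorCoord e W • ιMulti ℝ 2 e = W := by
  have h : (LinearMap.toSpanSingleton ℝ _ (ιMulti ℝ 2 e)).comp (bivectorCoord e)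
      = LinearMap.id := by
    refine linearMap_ext (Module.Basis.ext_alternating e fun v hv => ?_)
    have hdet : e.det (fun i => e (v i)) • ιMulti ℝ 2 e = ιMulti ℝ 2 fun i => e (v i) := by
      set σ := Equiv.ofBijective v hv.bijective_of_finite with hσ
      have h1 : (fun i => e (v i)) = e ∘ σ := rfl
      rw [h1, AlternatingMap.map_perm, AlternatingMap.map_perm, e.det_self]
      rw [smul_assoc, one_smul]
    simpa [bivectorCoord] using hdet
  exact LinearMap.congr_fun h W

theorem bivectorCoord_ne_zero (e : Module.Basis (Fin 2) ℝ M) {W : ⋀[ℝ]^2 M} (hW : W ≠ 0) :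
    bivectorCoord e W ≠ 0 := fun h => hW <| by
  rw [← bivectorCoord_smul_ιMulti e W, h, zero_smul]

/-- Bridge from the invariant equation to the form c · B(Df, Df). -/
theorem contractPhi_map (e : Module.Basis (Fin 2) ℝ M) (W : ⋀[ℝ]^2 M) (A : M →ₗ[ℝ] R7) :
    contractPhi (exteriorPower.map 2 A W)
      = bivectorCoord e W • crossPhi (A (e 0)) (A (e 1)) := by
  conv_lhs => rw [← bivectorCoord_smul_ιMulti e W]
  rw [map_smul, map_smul, map_apply_ιMulti, ← contractPhi_ιMulti]
  congr 3

end Bivectors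

/-! ### Chart representatives, local injectivity, orientation by φ -/

section ChartRepresentatives

open Filter

variable {E : Type*} [NormedAddCommGroup E] [NormedSpace ℝ E] {H : Type*} [TopologicalSpace H]
  {I : ModelWithCorners ℝ E H} {N : Type*} [TopologicalSpace N] [ChartedSpace H N]
  [I.Boundaryless]
  {F : Type*} [NormedAddCommGroup F] [NormedSpace ℝ F]

theorem isOpen_extChartAt_target_inter_preimage (q₀ : N) {U : Set N} (hU : IsOpen U) :
    IsOpen ((extChartAt I q₀).target ∩ (extChartAt I q₀).symm ⁻¹' U) :=
  (continuousOn_extChartAt_symm q₀).isOpen_inter_preimage (isOpen_extChartAt_target q₀) hU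

variable [IsManifold I ω N]

theorem analyticOnNhd_chartRep [CompleteSpace F] (q₀ : N) {f : N → F} {U : Set N} (hU : IsOpen U)
    (hf : ContMDiffOn I 𝓘(ℝ, F) ω f U) :
    AnalyticOnNhd ℝ (f ∘ (extChartAt I q₀).symm)
      ((extChartAt I q₀).target ∩ (extChartAt I q₀).symm ⁻¹' U) := by
  have h1 : ContMDiffOn 𝓘(ℝ, E) 𝓘(ℝ, F) ω (f ∘ (extChartAt I q₀).symm)
      ((extChartAt I q₀).target ∩ (extChartAt I q₀).symm ⁻¹' U) :=
    hf.comp ((contMDiffOn_extChartAt_symm q₀).mono inter_subset_left) fun x hx => hx.2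
  exact ((isOpen_extChartAt_target_inter_preimage q₀ hU).analyticOn_iff_analyticOnNhd).1
    (contMDiffOn_iff_contDiffOn.1 h1).analyticOn

theorem mdifferentiableAt_extChartAt_symm_of_boundaryless (q₀ : N) {x : E}
    (hx : x ∈ (extChartAt I q₀).target) :
    MDifferentiableAt 𝓘(ℝ, E) I (extChartAt I q₀).symm x :=
  ((contMDiffOn_extChartAt_symm (n := ω) q₀).contMDiffAt
    ((isOpen_extChartAt_target q₀).mem_nhds hx)).mdifferentiableAt (by simp)

/-- The derivative of a map on a manifold in terms of that of its chart representative. -/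
theorem mfderiv_eq_fderiv_chartRep_comp (q₀ : N) {f : N → F} {q : N}
    (hq : q ∈ (extChartAt I q₀).source) (hf : MDifferentiableAt I 𝓘(ℝ, F) f q) :
    DifferentiableAt ℝ (f ∘ (extChartAt I q₀).symm) (extChartAt I q₀ q) ∧
    mfderiv I 𝓘(ℝ, F) f q = (fderiv ℝ (f ∘ (extChartAt I q₀).symm) (extChartAt I q₀ q)).comp
      (mfderiv I 𝓘(ℝ, E) (extChartAt I q₀) q) := by
  have hx : extChartAt I q₀ q ∈ (extChartAt I q₀).target := (extChartAt I q₀).map_source hq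
  have hsymm := mdifferentiableAt_extChartAt_symm_of_boundaryless q₀ hx
  have hleft := (extChartAt I q₀).left_inv hq
  have h1 : MDifferentiableAt 𝓘(ℝ, E) 𝓘(ℝ, F) (f ∘ (extChartAt I q₀).symm)
      (extChartAt I q₀ q) :=
    MDifferentiableAt.comp _ (by rwa [hleft]) hsymm
  refine ⟨mdifferentiableAt_iff_differentiableAt.1 h1, ?_⟩
  have h2 : MDifferentiableAt I 𝓘(ℝ, E) (extChartAt I q₀) q :=
    mdifferentiableAt_extChartAt (by rwa [extChartAt_source] at hq)
  rw [← mfderiv_eq_fderiv]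
  have h3 : f =ᶠ[𝓝 q] (f ∘ (extChartAt I q₀).symm) ∘ extChartAt I q₀ := by
    filter_upwards [(isOpen_extChartAt_source (I := I) q₀).mem_nhds hq] with y hy
    exact congrArg f ((extChartAt I q₀).left_inv hy).symm
  have h4 : (mfderiv I 𝓘(ℝ, F) f q : E →L[ℝ] F)
      = mfderiv I 𝓘(ℝ, F) ((f ∘ (extChartAt I q₀).symm) ∘ extChartAt I q₀) q := h3.mfderiv_eq
  exact h4.trans (mfderiv_comp q h1 h2)

theorem exists_mfderiv_eq_fderiv_chartRep_comp (q₀ : N) {f : N → F} {q : N}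
    (hq : q ∈ (extChartAt I q₀).source) (hf : MDifferentiableAt I 𝓘(ℝ, F) f q) :
    ∃ D : E ≃L[ℝ] E, (D : E →L[ℝ] E) = mfderiv I 𝓘(ℝ, E) (extChartAt I q₀) q ∧
      (mfderiv I 𝓘(ℝ, F) f q : E →L[ℝ] F)
        = (fderiv ℝ (f ∘ (extChartAt I q₀).symm) (extChartAt I q₀ q)).comp D.toContinuousLinearMap := by
  have h1 := (mfderiv_eq_fderiv_chartRep_comp q₀ hq hf).2
  obtain ⟨D, hD⟩ : ∃ D : E ≃L[ℝ] E, (D : E →L[ℝ] E) = mfderiv I 𝓘(ℝ, E) (extChartAt I q₀) q :=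
    isInvertible_mfderiv_extChartAt hq
  exact ⟨D, hD, h1.trans (congrArg (ContinuousLinearMap.comp _) hD.symm)⟩

/-- A map is injective near a point where its derivative is injective. -/
theorem exists_injOn_of_injective_mfderiv [FiniteDimensional ℝ E] [CompleteSpace F]
    [FiniteDimensional ℝ F]
    {f : N → F} {U : Set N} (hU : IsOpen U) (hf : ContMDiffOn I 𝓘(ℝ, F) ω f U) {q : N} (hq : q ∈ U)
    (hinj : Function.Injective (mfderiv I 𝓘(ℝ, F) f q)) : ∃ O ∈ 𝓝 q, InjOn f O := by
  have hqs := mem_extChartAt_source (I := I) q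
  have hcompl : CompleteSpace E := FiniteDimensional.complete ℝ E
  have hfq : MDifferentiableAt I 𝓘(ℝ, F) f q :=
    (hf.contMDiffAt (hU.mem_nhds hq)).mdifferentiableAt (by simp)
  set x := extChartAt I q q with hx
  have hxW : x ∈ (extChartAt I q).target ∩ (extChartAt I q).symm ⁻¹' U :=
    ⟨mem_extChartAt_target q, by simpa [hx] using hq⟩
  have hstrict := (analyticOnNhd_chartRep q hU hf x hxW).hasStrictFDerivAt
  set L := fderiv ℝ (f ∘ (extChartAt I q).symm) x with hL
  have hLinj : Function.Injective L := by
    obtain ⟨D, h1⟩ := exists_mfderiv_eq_fderiv_chartRep_comp q hqs hfq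
    intro a b hab
    have h2 : ∀ v, (mfderiv I 𝓘(ℝ, F) f q : E →L[ℝ] F) (D.symm v) = L v := by
      intro v
      rw [h1.2]
      exact congrArg L (D.apply_symm_apply v)
    exact D.symm.injective (hinj ((h2 a).trans (hab.trans (h2 b).symm)))
  -- Composing with a left inverse of the derivative gives a map of E with derivative the identity,
  -- to which the inverse function theorem applies.
  obtain ⟨R, hR⟩ := LinearMap.exists_leftInverse_of_injective L.toLinearMap
    (LinearMap.ker_eq_bot.2 hLinj)
  set R' : F →L[ℝ] E := LinearMap.toContinuousLinearMap R with hR'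
  have hRL : R'.comp L = (ContinuousLinearEquiv.refl ℝ E : E →L[ℝ] E) := by
    ext v
    exact LinearMap.congr_fun hR v
  have hs2 := (R'.hasStrictFDerivAt (x := (f ∘ (extChartAt I q).symm) x)).comp x hstrict
  rw [hRL] at hs2
  set e := hs2.toOpenPartialHomeomorph with he
  have hxe : e.source ∈ 𝓝 x := e.open_source.mem_nhds hs2.mem_toOpenPartialHomeomorph_source
  refine ⟨(extChartAt I q).source ∩ extChartAt I q ⁻¹' e.source,
    inter_mem (extChartAt_source_mem_nhds q)
      ((continuousAt_extChartAt q).preimage_mem_nhds hxe), ?_⟩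
  intro a ha b hb hab
  refine (extChartAt I q).injOn ha.1 hb.1 (e.injOn ha.2 hb.2 ?_)
  change R' (f ((extChartAt I q).symm (extChartAt I q a)))
    = R' (f ((extChartAt I q).symm (extChartAt I q b)))
  rw [(extChartAt I q).left_inv ha.1, (extChartAt I q).left_inv hb.1, hab]

/-- A basis has the orientation given by a nonzero volume form exactly if the form is positive
on it. -/
theorem Module.Basis.orientation_eq_rayOfNeZero_iff {M : Type*} [AddCommGroup M] [Module ℝ M]
    (b : Module.Basis (Fin 3) ℝ M) {η : M [⋀^Fin 3]→ₗ[ℝ] ℝ} (hη : η ≠ 0) :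
    b.orientation = rayOfNeZero ℝ η hη ↔ 0 < η b := by
  have h := η.eq_smul_basis_det b
  rw [Module.Basis.orientation, ray_eq_iff]
  constructor
  · intro hs
    obtain ⟨c, hc, hcv⟩ := hs.exists_pos_right b.det_ne_zero hη
    have h1 := congrArg (fun f => f b) hcv
    simp only [b.det_self, AlternatingMap.smul_apply, smul_eq_mul] at h1
    by_contra hneg
    nlinarith
  · intro hpos
    rw [h]
    exact SameRay.sameRay_pos_smul_right _ hpos

/-- The orientation of a 3-manifold on which a pulled back 3-form is positive is continuous. -/
theorem isOrientationOn_of_phi (hE : Module.finrank ℝ E = 3) {f : N → R7} {U : Set N}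
    (hU : IsOpen U) (hf : ContMDiffOn I 𝓘(ℝ, R7) ω f U)
    (hφ : ∀ q ∈ U, phi.compLinearMap (mfderiv I 𝓘(ℝ, R7) f q).toLinearMap ≠ 0)
    {o : ∀ q : N, Orientation ℝ (TangentSpace I q) (Fin 3)}
    (ho : ∀ q (hq : q ∈ U), o q = rayOfNeZero ℝ _ (hφ q hq)) : IsOrientationOn I o U := by
  intro q₀ hq₀
  have hfin : FiniteDimensional ℝ E := FiniteDimensional.of_finrank_pos (by rw [hE]; norm_num)
  set g := f ∘ (extChartAt I q₀).symm with hg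
  set W := (extChartAt I q₀).target ∩ (extChartAt I q₀).symm ⁻¹' U with hW
  have hgan : AnalyticOnNhd ℝ g W := analyticOnNhd_chartRep q₀ hU hf
  have hmd : ∀ q ∈ U, MDifferentiableAt I 𝓘(ℝ, R7) f q := fun q hq =>
    (hf.contMDiffAt (hU.mem_nhds hq)).mdifferentiableAt (by simp)
  have hqs := mem_extChartAt_source (I := I) q₀
  set x₀ := extChartAt I q₀ q₀ with hx₀
  have hx₀W : x₀ ∈ W := ⟨mem_extChartAt_target q₀, by simpa [hx₀] using hq₀⟩
  have hη : phi.compLinearMap (fderiv ℝ g x₀).toLinearMap ≠ 0 := by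
    intro h0
    refine hφ q₀ hq₀ ?_
    have h1 := (mfderiv_eq_fderiv_chartRep_comp q₀ hqs (hmd q₀ hq₀)).2
    ext v
    have h2 := congrArg (fun η => η fun i => mfderiv I 𝓘(ℝ, E) (extChartAt I q₀) q₀ (v i)) h0
    rw [h1]
    exact h2
  -- A constant frame positive for φ at q₀; by continuity it remains positive at nearby points.
  set b₀ : Module.Basis (Fin 3) ℝ E :=
    (Module.finBasisOfFinrankEq ℝ E hE).adjustToOrientation (rayOfNeZero ℝ _ hη) with hb₀
  have hb₀pos : 0 < phi.compLinearMap (fderiv ℝ g x₀).toLinearMap b₀ :=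
    (b₀.orientation_eq_rayOfNeZero_iff hη).1
      (Module.Basis.orientation_adjustToOrientation _ _)
  have hphi : ∀ L : E →ₗ[ℝ] R7, phi.compLinearMap L b₀
      = inner ℝ (crossPhi (L (b₀ 0)) (L (b₀ 1))) (L (b₀ 2)) := by
    intro L
    rw [inner_crossPhi, AlternatingMap.compLinearMap_apply]
    congr 1
    funext i
    fin_cases i <;> rfl
  have hcont : ContinuousAt (fun x => phi.compLinearMap (fderiv ℝ g x).toLinearMap b₀) x₀ := by
    simp only [hphi, ContinuousLinearMap.coe_coe]
    have hd : ContinuousAt (fderiv ℝ g) x₀ := (hgan.fderiv x₀ hx₀W).continuousAt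
    fun_prop
  have hcont' : ContinuousAt (fun q => phi.compLinearMap
      (fderiv ℝ g (extChartAt I q₀ q)).toLinearMap b₀) q₀ :=
    ContinuousAt.comp (f := extChartAt I q₀) hcont (continuousAt_extChartAt q₀)
  refine ⟨b₀, ?_⟩
  filter_upwards [nhdsWithin_le_nhds (hcont'.eventually (lt_mem_nhds hb₀pos)),
    nhdsWithin_le_nhds (extChartAt_source_mem_nhds (I := I) q₀), self_mem_nhdsWithin]
    with q hpos hq hqU
  obtain ⟨D, hD, h1⟩ := exists_mfderiv_eq_fderiv_chartRep_comp q₀ hq (hmd q hqU)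
  refine ⟨b₀.map D.symm.toLinearEquiv, fun i => ?_, ?_⟩
  · exact (congrArg (fun T : E →L[ℝ] E => T (D.symm (b₀ i))) hD.symm).trans
      (D.apply_symm_apply (b₀ i))
  · rw [ho q hqU, Module.Basis.orientation_eq_rayOfNeZero_iff]
    refine lt_of_lt_of_eq hpos (congrArg phi (funext fun i => ?_))
    exact ((congrArg (fun T : E →L[ℝ] R7 => T (D.symm (b₀ i))) h1).trans
      (congrArg (fderiv ℝ g _) (D.apply_symm_apply (b₀ i)))).symm

end ChartRepresentatives

/-! ### Solutions on a surface: charts, uniqueness, gluing -/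

section LocalEvolution

open Filter

variable {P : Type*} [TopologicalSpace P] [ChartedSpace (EuclideanSpace ℝ (Fin 2)) P]

/-- The standard basis of the plane. -/
noncomputable def planeBasis : Module.Basis (Fin 2) ℝ (EuclideanSpace ℝ (Fin 2)) :=
  (EuclideanSpace.basisFun (Fin 2) ℝ).toBasis

/-- The cross product of the columns of two linear maps from the plane, one column of each. -/
noncomputable def columnCross : (EuclideanSpace ℝ (Fin 2) →L[ℝ] R7) →L[ℝ]
    (EuclideanSpace ℝ (Fin 2) →L[ℝ] R7) →L[ℝ] R7 :=
  crossPhi.bilinearComp (ContinuousLinearMap.apply ℝ R7 (planeBasis 0))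
    (ContinuousLinearMap.apply ℝ R7 (planeBasis 1))

/-- The coordinate expression of a bivector field on a surface. -/
noncomputable def chartBivector (χ : ∀ p : P, ⋀[ℝ]^2 (TangentSpace (𝓡 2) p)) (p₀ : P)
    (x : EuclideanSpace ℝ (Fin 2)) : ℝ :=
  bivectorCoord planeBasis (exteriorPower.map 2
    (mfderiv (𝓡 2) 𝓘(ℝ, EuclideanSpace ℝ (Fin 2)) (extChartAt (𝓡 2) p₀)
      ((extChartAt (𝓡 2) p₀).symm x)).toLinearMap (χ ((extChartAt (𝓡 2) p₀).symm x)))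

/-- `Ψ` is a solution of the evolution equation on the open set `N`, for times in `(-τ, τ)`. -/
structure IsEvolutionOn (χ : ∀ p : P, ⋀[ℝ]^2 (TangentSpace (𝓡 2) p)) (ψ : P → R7) (τ : ℝ)
    (N : Set P) (Ψ : ℝ → P → R7) : Prop where
  analytic : ContMDiffOn (𝓘(ℝ, ℝ).prod (𝓡 2)) 𝓘(ℝ, R7) ω (fun q : ℝ × P => Ψ q.1 q.2)
    (Ioo (-τ) τ ×ˢ N)
  initial : ∀ p ∈ N, Ψ 0 p = ψ p
  evolution : ∀ t ∈ Ioo (-τ) τ, ∀ p ∈ N,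
    HasDerivAt (fun s => Ψ s p)
      (contractPhi (exteriorPower.map 2 (mfderiv (𝓡 2) 𝓘(ℝ, R7) (Ψ t) p).toLinearMap (χ p))) t

variable {χ : ∀ p : P, ⋀[ℝ]^2 (TangentSpace (𝓡 2) p)} {ψ : P → R7} {τ : ℝ} {N : Set P}
  {Ψ Ψ' : ℝ → P → R7}

theorem isEvolutionOn_univ_iff :
    IsEvolutionOn χ ψ τ univ Ψ ↔ IsEvolution (𝓡 2) χ ψ τ Ψ :=
  ⟨fun h => ⟨h.analytic, funext fun p => h.initial p trivial,
    fun t ht p => h.evolution t ht p trivial⟩,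
   fun h => ⟨h.analytic, fun p _ => congrFun h.initial p, fun t ht p _ => h.evolution t ht p⟩⟩

theorem IsEvolutionOn.mono (h : IsEvolutionOn χ ψ τ N Ψ) {τ' : ℝ} (hτ : τ' ≤ τ) {N' : Set P}
    (hN : N' ⊆ N) : IsEvolutionOn χ ψ τ' N' Ψ where
  analytic := h.analytic.mono (prod_mono (Ioo_subset_Ioo (neg_le_neg hτ) hτ) hN)
  initial p hp := h.initial p (hN hp)
  evolution t ht p hp := h.evolution t (Ioo_subset_Ioo (neg_le_neg hτ) hτ ht) p (hN hp)

theorem IsEvolutionOn.congr (hN : IsOpen N) (hτ : 0 < τ) (h : IsEvolutionOn χ ψ τ N Ψ)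
    (hΨ : ∀ t ∈ Ioo (-τ) τ, ∀ p ∈ N, Ψ' t p = Ψ t p) : IsEvolutionOn χ ψ τ N Ψ' where
  analytic := h.analytic.congr fun q hq => hΨ q.1 hq.1 q.2 hq.2
  initial p hp := (hΨ 0 ⟨neg_lt_zero.2 hτ, hτ⟩ p hp).trans (h.initial p hp)
  evolution t ht p hp := by
    have h1 : (mfderiv (𝓡 2) 𝓘(ℝ, R7) (Ψ' t) p : EuclideanSpace ℝ (Fin 2) →L[ℝ] R7)
        = mfderiv (𝓡 2) 𝓘(ℝ, R7) (Ψ t) p := by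
      refine Filter.EventuallyEq.mfderiv_eq ?_
      filter_upwards [hN.mem_nhds hp] with y hy using hΨ t ht y hy
    have h2 := (h.evolution t ht p hp).congr_of_eventuallyEq (f := fun s => Ψ s p)
      (f₁ := fun s => Ψ' s p) (by
        filter_upwards [isOpen_Ioo.mem_nhds ht] with s hs using hΨ s hs p hp)
    have h3 : ∀ A A' : EuclideanSpace ℝ (Fin 2) →L[ℝ] R7, A = A' →
      HasDerivAt (fun s => Ψ' s p) (contractPhi (exteriorPower.map 2 A'.toLinearMap (χ p))) t →
      HasDerivAt (fun s => Ψ' s p) (contractPhi (exteriorPower.map 2 A.toLinearMap (χ p))) t := by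
      rintro A _ rfl h
      exact h
    exact h3 _ _ h1 h2

theorem IsEvolutionOn.contMDiffOn (h : IsEvolutionOn χ ψ τ N Ψ) {t : ℝ} (ht : t ∈ Ioo (-τ) τ) :
    ContMDiffOn (𝓡 2) 𝓘(ℝ, R7) ω (Ψ t) N :=
  h.analytic.comp (contMDiff_const.prodMk contMDiff_id).contMDiffOn fun _ hp => ⟨ht, hp⟩

theorem IsEvolutionOn.mdifferentiableAt (hN : IsOpen N) (h : IsEvolutionOn χ ψ τ N Ψ) {t : ℝ}
    (ht : t ∈ Ioo (-τ) τ) {p : P} (hp : p ∈ N) :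
    MDifferentiableAt (𝓡 2) 𝓘(ℝ, R7) (Ψ t) p :=
  ((h.contMDiffOn ht).contMDiffAt (hN.mem_nhds hp)).mdifferentiableAt (by simp)

theorem isEvolutionOn_of_forall_exists (h : ∀ p ∈ N, ∃ N', IsOpen N' ∧ p ∈ N' ∧
    IsEvolutionOn χ ψ τ N' Ψ) : IsEvolutionOn χ ψ τ N Ψ where
  analytic q hq := by
    obtain ⟨N', hN', hp, hev⟩ := h q.2 hq.2
    exact (hev.analytic.contMDiffAt ((isOpen_Ioo.prod hN').mem_nhds ⟨hq.1, hp⟩)).contMDiffWithinAt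
  initial p hp := by
    obtain ⟨N', hN', hp, hev⟩ := h p hp
    exact hev.initial p hp
  evolution t ht p hp := by
    obtain ⟨N', hN', hp, hev⟩ := h p hp
    exact hev.evolution t ht p hp

variable [IsManifold (𝓡 2) ω P]

/-- The right hand side of the evolution equation in a chart. -/
theorem contractPhi_map_mfderiv_eq {p₀ p : P} (hp : p ∈ (extChartAt (𝓡 2) p₀).source) {g : P → R7}
    (hg : MDifferentiableAt (𝓡 2) 𝓘(ℝ, R7) g p) :
    contractPhi (exteriorPower.map 2 (mfderiv (𝓡 2) 𝓘(ℝ, R7) g p).toLinearMap (χ p))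
      = chartBivector χ p₀ (extChartAt (𝓡 2) p₀ p) •
        columnCross (fderiv ℝ (g ∘ (extChartAt (𝓡 2) p₀).symm) (extChartAt (𝓡 2) p₀ p))
          (fderiv ℝ (g ∘ (extChartAt (𝓡 2) p₀).symm) (extChartAt (𝓡 2) p₀ p)) := by
  have h1 := (mfderiv_eq_fderiv_chartRep_comp p₀ hp hg).2
  set L := fderiv ℝ (g ∘ (extChartAt (𝓡 2) p₀).symm) (extChartAt (𝓡 2) p₀ p) with hL
  have hc : chartBivector χ p₀ (extChartAt (𝓡 2) p₀ p) = bivectorCoord planeBasis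
      (exteriorPower.map 2 (mfderiv (𝓡 2) 𝓘(ℝ, EuclideanSpace ℝ (Fin 2))
        (extChartAt (𝓡 2) p₀) p).toLinearMap (χ p)) := by
    have : ∀ y, y = p → bivectorCoord planeBasis
      (exteriorPower.map 2 (mfderiv (𝓡 2) 𝓘(ℝ, EuclideanSpace ℝ (Fin 2))
        (extChartAt (𝓡 2) p₀) y).toLinearMap (χ y)) = bivectorCoord planeBasis
      (exteriorPower.map 2 (mfderiv (𝓡 2) 𝓘(ℝ, EuclideanSpace ℝ (Fin 2))
        (extChartAt (𝓡 2) p₀) p).toLinearMap (χ p)) := by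
      rintro _ rfl
      rfl
    exact this _ ((extChartAt (𝓡 2) p₀).left_inv hp)
  have h2 : ∀ (D : EuclideanSpace ℝ (Fin 2) →L[ℝ] EuclideanSpace ℝ (Fin 2))
      (B : EuclideanSpace ℝ (Fin 2) →L[ℝ] R7) (W : ⋀[ℝ]^2 (EuclideanSpace ℝ (Fin 2))),
      B = L.comp D → contractPhi (exteriorPower.map 2 B.toLinearMap W)
        = bivectorCoord planeBasis (exteriorPower.map 2 D.toLinearMap W) • columnCross L L := by
    rintro D _ W rfl
    have h3 : (L.comp D).toLinearMap = L.toLinearMap ∘ₗ D.toLinearMap := rfl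
    rw [h3, exteriorPower.map_comp, LinearMap.comp_apply, contractPhi_map planeBasis]
    rfl
  rw [hc]
  exact h2 _ _ (χ p) h1

theorem IsEvolutionOn.chartRep (hN : IsOpen N) (h : IsEvolutionOn χ ψ τ N Ψ) (p₀ : P) :
    AnalyticOnNhd ℝ (fun z : ℝ × EuclideanSpace ℝ (Fin 2) =>
        Ψ z.1 ((extChartAt (𝓡 2) p₀).symm z.2))
      (Ioo (-τ) τ ×ˢ ((extChartAt (𝓡 2) p₀).target ∩ (extChartAt (𝓡 2) p₀).symm ⁻¹' N)) ∧
    ∀ t ∈ Ioo (-τ) τ, ∀ x ∈ (extChartAt (𝓡 2) p₀).target ∩ (extChartAt (𝓡 2) p₀).symm ⁻¹' N,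
      HasDerivAt (fun s => Ψ s ((extChartAt (𝓡 2) p₀).symm x)) (chartBivector χ p₀ x •
        columnCross (fderiv ℝ (fun y => Ψ t ((extChartAt (𝓡 2) p₀).symm y)) x)
          (fderiv ℝ (fun y => Ψ t ((extChartAt (𝓡 2) p₀).symm y)) x)) t := by
  set V := (extChartAt (𝓡 2) p₀).target ∩ (extChartAt (𝓡 2) p₀).symm ⁻¹' N with hV
  have hVo : IsOpen V := isOpen_extChartAt_target_inter_preimage p₀ hN
  constructor
  · have h1 : ContMDiffOn 𝓘(ℝ, ℝ × EuclideanSpace ℝ (Fin 2)) (𝓘(ℝ, ℝ).prod (𝓡 2)) ω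
        (fun z : ℝ × EuclideanSpace ℝ (Fin 2) => (z.1, (extChartAt (𝓡 2) p₀).symm z.2))
        (Ioo (-τ) τ ×ˢ V) := by
      refine ContMDiffOn.prodMk contDiff_fst.contMDiff.contMDiffOn ?_
      exact (contMDiffOn_extChartAt_symm p₀).comp contDiff_snd.contMDiff.contMDiffOn
        fun z hz => hz.2.1
    have h2 := h.analytic.comp h1 fun z hz => ⟨hz.1, hz.2.2⟩
    exact ((isOpen_Ioo.prod hVo).analyticOn_iff_analyticOnNhd).1
      (contMDiffOn_iff_contDiffOn.1 h2).analyticOn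
  · intro t ht x hx
    have h1 := h.evolution t ht _ hx.2
    have h2 := contractPhi_map_mfderiv_eq (χ := χ) ((extChartAt (𝓡 2) p₀).map_target hx.1)
      (h.mdifferentiableAt hN ht hx.2)
    rw [(extChartAt (𝓡 2) p₀).right_inv hx.1] at h2
    rw [h2] at h1
    exact h1

theorem IsAnalyticBivector.analyticOnNhd_chartBivector (hχ : IsAnalyticBivector (𝓡 2) χ) (p₀ : P) :
    AnalyticOnNhd ℝ (chartBivector χ p₀) (extChartAt (𝓡 2) p₀).target := by
  have h := analyticOnNhd_chartRep (I := 𝓡 2) p₀ (chartAt (EuclideanSpace ℝ (Fin 2)) p₀).open_source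
    (hχ p₀ (bivectorCoord planeBasis))
  refine h.mono fun x hx => ⟨hx, ?_⟩
  have := (extChartAt (𝓡 2) p₀).map_target hx
  rwa [extChartAt_source] at this

/-- Chartwise uniqueness at each point. That N is an arbitrary open set matters for gluing, where it
is an overlap. -/
theorem IsEvolutionOn.unique (hχ : IsAnalyticBivector (𝓡 2) χ) (hN : IsOpen N)
    (h : IsEvolutionOn χ ψ τ N Ψ) (h' : IsEvolutionOn χ ψ τ N Ψ') :
    ∀ t ∈ Ioo (-τ) τ, ∀ p ∈ N, Ψ t p = Ψ' t p := by
  intro t ht p hp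
  obtain ⟨h1, h2⟩ := h.chartRep hN p
  obtain ⟨h1', h2'⟩ := h'.chartRep hN p
  have h3 := analytic_evolution_unique (isOpen_extChartAt_target_inter_preimage p hN)
    ((hχ.analyticOnNhd_chartBivector p).mono inter_subset_left) h1 h1'
    (fun x hx => (h.initial _ hx.2).trans (h'.initial _ hx.2).symm) h2 h2' t ht
    (extChartAt (𝓡 2) p p) ⟨mem_extChartAt_target p, by simpa using hp⟩
  simpa using h3

theorem exists_isEvolutionOn (hχ : IsAnalyticBivector (𝓡 2) χ)
    (hψ : ContMDiffOn (𝓡 2) 𝓘(ℝ, R7) ω ψ univ) (p₀ : P) :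
    ∃ τ, 0 < τ ∧ ∃ N, IsOpen N ∧ p₀ ∈ N ∧ ∃ Ψ, IsEvolutionOn χ ψ τ N Ψ := by
  have hx₀ := mem_extChartAt_target (I := 𝓡 2) p₀
  obtain ⟨τ, hτ, U, hU, hxU, Φ, hΦ, hΦ0, hΦev⟩ := exists_analytic_evolution (B := columnCross)
    (hχ.analyticOnNhd_chartBivector p₀ _ hx₀)
    (analyticOnNhd_chartRep p₀ isOpen_univ hψ _ ⟨hx₀, trivial⟩)
  set N := (extChartAt (𝓡 2) p₀).source ∩ extChartAt (𝓡 2) p₀ ⁻¹' U with hN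
  have hNo : IsOpen N :=
    (continuousOn_extChartAt p₀).isOpen_inter_preimage (isOpen_extChartAt_source p₀) hU
  have han : ContMDiffOn (𝓘(ℝ, ℝ).prod (𝓡 2)) 𝓘(ℝ, R7) ω
      (fun q : ℝ × P => Φ (q.1, extChartAt (𝓡 2) p₀ q.2)) (Ioo (-τ) τ ×ˢ N) := by
    have h1 : ContMDiffOn (𝓘(ℝ, ℝ).prod (𝓡 2)) 𝓘(ℝ, ℝ × EuclideanSpace ℝ (Fin 2)) ω
        (fun q : ℝ × P => (q.1, extChartAt (𝓡 2) p₀ q.2)) (Ioo (-τ) τ ×ˢ N) := by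
      refine ContMDiffOn.prodMk_space contMDiff_fst.contMDiffOn ?_
      refine (contMDiffOn_extChartAt (x := p₀)).comp contMDiff_snd.contMDiffOn fun q hq => ?_
      simpa [extChartAt_source] using hq.2.1
    exact (contMDiffOn_iff_contDiffOn.2
      (hΦ.contDiffOn (isOpen_Ioo.prod hU).uniqueDiffOn)).comp h1 fun q hq => ⟨hq.1, hq.2.2⟩
  refine ⟨τ, hτ, N, hNo, ⟨mem_extChartAt_source p₀, hxU⟩,
    fun t p => Φ (t, extChartAt (𝓡 2) p₀ p), han, ?_, ?_⟩
  · intro p hp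
    exact (hΦ0 _).trans (congrArg ψ ((extChartAt (𝓡 2) p₀).left_inv hp.1))
  · intro t ht p hp
    have hmd : MDifferentiableAt (𝓡 2) 𝓘(ℝ, R7) (fun p => Φ (t, extChartAt (𝓡 2) p₀ p)) p :=
      ((han.comp (contMDiff_const.prodMk contMDiff_id).contMDiffOn fun _ hp =>
        ⟨ht, hp⟩ : ContMDiffOn (𝓡 2) 𝓘(ℝ, R7) ω (fun p => Φ (t, extChartAt (𝓡 2) p₀ p)) N).contMDiffAt
        (hNo.mem_nhds hp)).mdifferentiableAt (by simp)
    have h1 : fderiv ℝ ((fun p => Φ (t, extChartAt (𝓡 2) p₀ p)) ∘ (extChartAt (𝓡 2) p₀).symm)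
        (extChartAt (𝓡 2) p₀ p) = fderiv ℝ (fun y => Φ (t, y)) (extChartAt (𝓡 2) p₀ p) := by
      refine Filter.EventuallyEq.fderiv_eq ?_
      filter_upwards [(isOpen_extChartAt_target (I := 𝓡 2) p₀).mem_nhds
        ((extChartAt (𝓡 2) p₀).map_source hp.1)] with y hy
      exact congrArg (fun y => Φ (t, y)) ((extChartAt (𝓡 2) p₀).right_inv hy)
    rw [contractPhi_map_mfderiv_eq hp.1 hmd, h1]
    exact hΦev t ht _ hp.2

/-- On a compact surface the evolution equation has a solution for small times. -/
theorem exists_isEvolution [CompactSpace P] (hχ : IsAnalyticBivector (𝓡 2) χ)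
    (hψ : ContMDiffOn (𝓡 2) 𝓘(ℝ, R7) ω ψ univ) :
    ∃ ε, 0 < ε ∧ ∃ Ψ, IsEvolutionOn χ ψ ε univ Ψ := by
  choose τ hτ N hN hpN Ψ hΨ using exists_isEvolutionOn hχ hψ
  obtain ⟨s, hs⟩ := CompactSpace.elim_nhds_subcover N fun p => (hN p).mem_nhds (hpN p)
  have hcov : ∀ p, ∃ i ∈ s, p ∈ N i := fun p => by
    have : p ∈ ⋃ x ∈ s, N x := hs ▸ mem_univ p
    simpa using this
  choose i his hiN using hcov
  obtain ⟨ε, hετ, hε⟩ : ∃ ε, (∀ j ∈ s, ε < τ j) ∧ 0 < ε := by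
    have h1 : ∀ᶠ ε in 𝓝[>] (0 : ℝ), ∀ j ∈ s, ε < τ j :=
      (Finset.eventually_all s).2 fun j _ => nhdsWithin_le_nhds (gt_mem_nhds (hτ j))
    exact (h1.and self_mem_nhdsWithin).exists
  -- The index i(p) may jump with p, but on overlaps the local solutions agree, so near p this is
  -- the single solution Ψ (i p).
  refine ⟨ε, hε, fun t p => Ψ (i p) t p, isEvolutionOn_of_forall_exists fun p _ =>
    ⟨N (i p), hN _, hiN p, ?_⟩⟩
  have hev := (hΨ (i p)).mono (hετ _ (his p)).le Subset.rfl
  refine hev.congr (hN _) hε fun t ht q hq => ?_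
  exact IsEvolutionOn.unique hχ ((hN (i q)).inter (hN (i p)))
    ((hΨ (i q)).mono (hετ _ (his q)).le inter_subset_left) (hev.mono le_rfl inter_subset_right)
    t ht q ⟨hiN q, hq⟩

end LocalEvolution

/-! ### Associativity and embeddedness of the swept 3-fold -/

section AssociativeSweep

open Filter

/-- Equality in Cauchy–Schwarz: if u × v = 0 then |u|² v - ⟨u, v⟩ u has norm zero, a linear
relation. -/
theorem crossPhi_ne_zero {u v : R7} (h : LinearIndependent ℝ ![u, v]) : crossPhi u v ≠ 0 := by
  intro h0
  have h1 := norm_sq_crossPhi u v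
  rw [h0, norm_zero, zero_pow two_ne_zero] at h1
  have h2 : ‖-inner ℝ u v • u + ‖u‖ ^ 2 • v‖ ^ 2 = 0 := by
    rw [← real_inner_self_eq_norm_sq]
    simp only [inner_add_left, inner_add_right, inner_smul_left, inner_smul_right,
      real_inner_self_eq_norm_sq, real_inner_comm u v, starRingEnd_apply, star_trivial]
    linear_combination (-‖u‖ ^ 2) * h1
  have h3 := (LinearIndependent.pair_iff.1 h _ _
    (norm_eq_zero.1 (pow_eq_zero_iff two_ne_zero |>.1 h2))).2
  have hu : u ≠ 0 := h.ne_zero 0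
  exact hu (norm_eq_zero.1 (pow_eq_zero_iff two_ne_zero |>.1 h3))

/-- A linear map from `ℝ × ℝ²` sending the first basis vector to a nonzero multiple of the cross
product of the images of the others parametrizes an associative 3-plane. -/
theorem isAssociativePlane_range_of_eq_smul_crossPhi
    {L : ℝ × EuclideanSpace ℝ (Fin 2) →ₗ[ℝ] R7} {c : ℝ}
    (hL : L (1, 0) = c • crossPhi (L (0, planeBasis 0)) (L (0, planeBasis 1)))
    (hne : L (1, 0) ≠ 0) :
    Function.Injective L ∧ ∃ hη : phi.compLinearMap L ≠ 0, ∀ hinj : Function.Injective L,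
      IsAssociativePlane (LinearMap.range L)
        (Orientation.map (Fin 3) (LinearEquiv.ofInjective L hinj) (rayOfNeZero ℝ _ hη)) := by
  set u := L (0, planeBasis 0) with hu
  set v := L (0, planeBasis 1) with hv
  have hc : c ≠ 0 := by
    rintro rfl
    exact hne (by rw [hL, zero_smul])
  have hx : crossPhi u v ≠ 0 := by
    intro h
    exact hne (by rw [hL, h, smul_zero])
  have hη : phi.compLinearMap L ≠ 0 := by
    intro h0
    have h1 := congrArg (fun η => η ![(0, planeBasis 0), (0, planeBasis 1), (1, 0)]) h0
    have h2 : (fun i => L (![(0, planeBasis 0), (0, planeBasis 1), (1, 0)] i))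
        = ![u, v, L (1, 0)] := by
      funext i
      fin_cases i <;> rfl
    simp only [AlternatingMap.compLinearMap_apply, h2, AlternatingMap.zero_apply] at h1
    rw [← inner_crossPhi, hL, inner_smul_right, real_inner_self_eq_norm_sq] at h1
    exact mul_ne_zero hc (pow_ne_zero 2 (norm_ne_zero_iff.2 hx)) h1
  have hinj : Function.Injective L := by
    refine (injective_iff_map_eq_zero L).2 ?_
    rintro ⟨a, ξ⟩ h0
    have hξ : ξ = planeBasis.repr ξ 0 • planeBasis 0 + planeBasis.repr ξ 1 • planeBasis 1 := by
      rw [← Fin.sum_univ_two (fun i => planeBasis.repr ξ i • planeBasis i),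
        planeBasis.sum_repr]
    set r := planeBasis.repr ξ 0 with hr
    set s := planeBasis.repr ξ 1 with hs
    have hdec : ((a, ξ) : ℝ × EuclideanSpace ℝ (Fin 2))
        = a • (1, 0) + (r • (0, planeBasis 0) + s • (0, planeBasis 1)) := by
      rw [hξ]
      simp
    rw [hdec, map_add, map_add, map_smul, map_smul, map_smul, ← hu, ← hv] at h0
    -- Pairing with u × v isolates a; then crossing with v and with u isolates r and s.
    have ha : a = 0 := by
      have h1 := congrArg (inner ℝ (crossPhi u v)) h0
      rw [hL] at h1
      simp only [inner_add_right, inner_smul_right, inner_crossPhi_left, inner_crossPhi_right,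
        real_inner_self_eq_norm_sq, mul_zero, add_zero, inner_zero_right] at h1
      exact (mul_eq_zero.1 h1).resolve_right
        (mul_ne_zero hc (pow_ne_zero 2 (norm_ne_zero_iff.2 hx)))
    rw [ha, zero_smul, zero_add] at h0
    have hr0 : r = 0 := by
      have h1 := congrArg (fun y => crossPhi y v) h0
      simp only [map_add, map_smul, add_apply, smul_apply, crossPhi_self, smul_zero, add_zero,
        map_zero, zero_apply] at h1
      exact (smul_eq_zero.1 h1).resolve_right hx
    have hs0 : s = 0 := by
      have h1 := congrArg (crossPhi u) h0
      simp only [map_add, map_smul, crossPhi_self, smul_zero, zero_add, map_zero] at h1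
      exact (smul_eq_zero.1 h1).resolve_right hx
    rw [hξ, ha, hr0, hs0]
    simp
  refine ⟨hinj, hη, fun hinj => ?_⟩
  have hmem : ∀ z, L z ∈ LinearMap.range L := fun z => LinearMap.mem_range_self L z
  have hsub : (phi.compLinearMap L).compLinearMap (LinearEquiv.ofInjective L hinj).symm.toLinearMap
      = phi.compLinearMap (LinearMap.range L).subtype := by
    ext x
    simp only [AlternatingMap.compLinearMap_apply]
    refine congrArg phi (funext fun i => ?_)
    exact congrArg Subtype.val ((LinearEquiv.ofInjective L hinj).apply_symm_apply (x i))
  have hφ : phi.compLinearMap (LinearMap.range L).subtype ≠ 0 := by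
    rw [← hsub]
    exact mt ((phi.compLinearMap L).compLinearEquiv_eq_zero_iff _).1 hη
  refine isAssociativePlane_of_crossPhi_mem ?_ (hmem (0, planeBasis 0)) (hmem (0, planeBasis 1))
    ?_ hx hφ ?_
  · rw [LinearMap.finrank_range_of_inj hinj]
    simp
  · have h1 : crossPhi u v = c⁻¹ • L (1, 0) := by
      rw [hL, smul_smul, inv_mul_cancel₀ hc, one_smul]
    rw [← hu, ← hv, h1]
    exact Submodule.smul_mem _ _ (hmem _)
  · rw [Orientation.map_apply]
    congr 1

/-- A continuous injection of the compact closed slab into a Hausdorff space is a closed embedding,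
and it restricts to the open slab. -/
theorem isEmbedding_domRestrict_Ioo_prod {P : Type*} [TopologicalSpace P] [CompactSpace P]
    {f : ℝ × P → R7} {a b : ℝ}
    (hf : ContinuousOn f (Icc a b ×ˢ univ)) (hinj : InjOn f (Icc a b ×ˢ univ)) :
    IsEmbedding ((Ioo a b ×ˢ (univ : Set P)).domRestrict f) := by
  have hc : CompactSpace (Icc a b ×ˢ (univ : Set P) : Set (ℝ × P)) :=
    isCompact_iff_compactSpace.1 (isCompact_Icc.prod isCompact_univ)
  have h1 : IsEmbedding ((Icc a b ×ˢ (univ : Set P)).domRestrict f) :=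
    ((continuousOn_iff_continuous_domRestrict.1 hf).isClosedEmbedding
      (injOn_iff_injective.1 hinj)).isEmbedding
  exact h1.comp (IsEmbedding.inclusion (Set.prod_mono Ioo_subset_Icc_self Subset.rfl))

variable {P : Type*} [TopologicalSpace P] [ChartedSpace (EuclideanSpace ℝ (Fin 2)) P]
  {χ : ∀ p : P, ⋀[ℝ]^2 (TangentSpace (𝓡 2) p)} {ψ : P → R7} {ε : ℝ} {Ψ : ℝ → P → R7}

/-- Applied at time zero, where it makes the initial velocity nonzero; at later times nonvanishing
velocity alone gives the immersion. -/
theorem contractPhi_map_ne_zero {p : P} (hχ : χ p ≠ 0)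
    (hψ : Function.Injective (mfderiv (𝓡 2) 𝓘(ℝ, R7) ψ p)) :
    contractPhi (exteriorPower.map 2 (mfderiv (𝓡 2) 𝓘(ℝ, R7) ψ p).toLinearMap (χ p)) ≠ 0 := by
  have h : ∀ (A : EuclideanSpace ℝ (Fin 2) →ₗ[ℝ] R7) (W : ⋀[ℝ]^2 (EuclideanSpace ℝ (Fin 2))),
      W ≠ 0 → Function.Injective A → contractPhi (exteriorPower.map 2 A W) ≠ 0 := by
    intro A W hW hA
    rw [contractPhi_map planeBasis]
    refine smul_ne_zero (bivectorCoord_ne_zero _ hW) (crossPhi_ne_zero ?_)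
    have h1 := planeBasis.linearIndependent.map' A (LinearMap.ker_eq_bot.2 hA)
    have h2 : A ∘ planeBasis = ![A (planeBasis 0), A (planeBasis 1)] := by
      funext i
      fin_cases i <;> rfl
    rwa [h2] at h1
  exact h _ (χ p) hχ hψ

theorem IsEvolutionOn.mdifferentiableAt_uncurry (h : IsEvolutionOn χ ψ ε univ Ψ) {q : ℝ × P}
    (hq : q ∈ Ioo (-ε) ε ×ˢ (univ : Set P)) :
    MDifferentiableAt (𝓘(ℝ, ℝ).prod (𝓡 2)) 𝓘(ℝ, R7) (fun q : ℝ × P => Ψ q.1 q.2) q :=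
  (h.analytic.contMDiffAt ((isOpen_Ioo.prod isOpen_univ).mem_nhds hq)).mdifferentiableAt (by simp)

/-- The derivative of a solution of the evolution equation in space and time. -/
theorem IsEvolutionOn.mfderiv_apply (h : IsEvolutionOn χ ψ ε univ Ψ) {q : ℝ × P}
    (hq : q ∈ Ioo (-ε) ε ×ˢ (univ : Set P)) {L : ℝ × EuclideanSpace ℝ (Fin 2) →L[ℝ] R7}
    {A : EuclideanSpace ℝ (Fin 2) →L[ℝ] R7}
    (hL : L = mfderiv (𝓘(ℝ, ℝ).prod (𝓡 2)) 𝓘(ℝ, R7) (fun q : ℝ × P => Ψ q.1 q.2) q)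
    (hA : A = mfderiv (𝓡 2) 𝓘(ℝ, R7) (Ψ q.1) q.2) (a : ℝ) (ξ : EuclideanSpace ℝ (Fin 2)) :
    L (a, ξ) = a • deriv (fun s => Ψ s q.2) q.1 + A ξ := by
  obtain ⟨B, hB⟩ : ∃ B : ℝ →L[ℝ] R7, B = mfderiv 𝓘(ℝ, ℝ) 𝓘(ℝ, R7) (fun s => Ψ s q.2) q.1 :=
    ⟨_, rfl⟩
  have h1 : L (a, ξ) = B a + A ξ := by
    subst hL hA hB
    exact mfderiv_prod_eq_add_apply (v := (a, ξ)) (h.mdifferentiableAt_uncurry hq)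
  have h2 : B = fderiv ℝ (fun s => Ψ s q.2) q.1 := hB.trans mfderiv_eq_fderiv
  rw [h1, h2, ← fderiv_apply_one_eq_deriv, ← map_smul, smul_eq_mul, mul_one]

variable [IsManifold (𝓡 2) ω P]

/-- The set of points where the velocity of a solution does not vanish is open. -/
theorem IsEvolutionOn.eventually_deriv_ne_zero (h : IsEvolutionOn χ ψ ε univ Ψ) {q₀ : ℝ × P}
    (hq₀ : q₀ ∈ Ioo (-ε) ε ×ˢ (univ : Set P)) (hne : deriv (fun s => Ψ s q₀.2) q₀.1 ≠ 0) :
    ∀ᶠ q : ℝ × P in 𝓝 q₀, deriv (fun s => Ψ s q.2) q.1 ≠ 0 := by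
  have han := (h.chartRep isOpen_univ q₀.2).1
  set g := extChartAt (𝓡 2) q₀.2 with hg
  set Φ : ℝ × EuclideanSpace ℝ (Fin 2) → R7 := fun z => Ψ z.1 (g.symm z.2) with hΦ
  have hderiv : ∀ q ∈ Ioo (-ε) ε ×ˢ g.source,
      deriv (fun s => Ψ s q.2) q.1 = fderiv ℝ Φ (q.1, g q.2) (1, 0) := by
    intro q hq
    have hd := (han (q.1, g q.2) ⟨hq.1, g.map_source hq.2, trivial⟩).differentiableAt.hasFDerivAt
    have h1 := (HasFDerivAt.comp q.1 hd (hasFDerivAt_prodMk_left q.1 (g q.2))).hasDerivAt.deriv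
    have h2 : (fun s => Ψ s q.2) = Φ ∘ fun s => (s, g q.2) := by
      funext s
      exact congrArg (Ψ s) (g.left_inv hq.2).symm
    rw [h2, h1]
    simp
  have hs := mem_extChartAt_source (I := 𝓡 2) q₀.2
  have hcont : ContinuousAt (fun q : ℝ × P => fderiv ℝ Φ (q.1, g q.2) (1, 0)) q₀ := by
    have h1 : ContinuousAt (fun z => fderiv ℝ Φ z (1, 0)) (q₀.1, g q₀.2) :=
      (han (q₀.1, g q₀.2) ⟨hq₀.1, g.map_source hs, trivial⟩).fderiv.continuousAt.clm_apply
        continuousAt_const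
    refine ContinuousAt.comp (f := fun q : ℝ × P => (q.1, g q.2)) h1
      (continuousAt_fst.prodMk ?_)
    exact (continuousAt_extChartAt (I := 𝓡 2) q₀.2).comp continuousAt_snd
  rw [hderiv q₀ ⟨hq₀.1, hs⟩] at hne
  filter_upwards [hcont.eventually_ne hne,
    (isOpen_Ioo.prod (isOpen_extChartAt_source (I := 𝓡 2) q₀.2)).mem_nhds ⟨hq₀.1, hs⟩] with q h1 h2
  rwa [hderiv q h2]

/-- A solution of the evolution equation with nowhere vanishing velocity sweeps out an associative
3-fold. -/
theorem IsEvolutionOn.isAssociativeImmersionOn (h : IsEvolutionOn χ ψ ε univ Ψ)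
    (hne : ∀ q ∈ Ioo (-ε) ε ×ˢ (univ : Set P), deriv (fun s => Ψ s q.2) q.1 ≠ 0) :
    IsAssociativeImmersionOn (𝓘(ℝ, ℝ).prod (𝓡 2)) (fun q : ℝ × P => Ψ q.1 q.2)
      (Ioo (-ε) ε ×ˢ univ) := by
  classical
  have hE : Module.finrank ℝ (ℝ × EuclideanSpace ℝ (Fin 2)) = 3 := by simp
  have key' : ∀ q ∈ Ioo (-ε) ε ×ˢ (univ : Set P), ∀ L : ℝ × EuclideanSpace ℝ (Fin 2) →L[ℝ] R7,
      L = mfderiv (𝓘(ℝ, ℝ).prod (𝓡 2)) 𝓘(ℝ, R7) (fun q : ℝ × P => Ψ q.1 q.2) q →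
      L (1, 0) = bivectorCoord planeBasis (χ q.2) •
        crossPhi (L (0, planeBasis 0)) (L (0, planeBasis 1)) ∧ L (1, 0) ≠ 0 := by
    intro q hq L hL
    obtain ⟨A, hA⟩ : ∃ A : EuclideanSpace ℝ (Fin 2) →L[ℝ] R7,
      A = mfderiv (𝓡 2) 𝓘(ℝ, R7) (Ψ q.1) q.2 := ⟨_, rfl⟩
    have h2 : deriv (fun s => Ψ s q.2) q.1 = bivectorCoord planeBasis (χ q.2) •
        crossPhi (A (planeBasis 0)) (A (planeBasis 1)) := by
      rw [(h.evolution q.1 hq.1 q.2 trivial).deriv]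
      subst hA
      exact contractPhi_map planeBasis (χ q.2) _
    simp only [h.mfderiv_apply hq hL hA, map_zero, add_zero, one_smul, zero_smul, zero_add]
    exact ⟨h2, hne q hq⟩
  have key := fun q hq => isAssociativePlane_range_of_eq_smul_crossPhi
    (key' q hq _ rfl).1 (key' q hq _ rfl).2
  -- The orientation for which the pulled back φ is positive. The other branch never occurs on the
  -- slab.
  let o : ∀ q : ℝ × P, Orientation ℝ (TangentSpace (𝓘(ℝ, ℝ).prod (𝓡 2)) q) (Fin 3) := fun q =>
    if hη : phi.compLinearMap (mfderiv (𝓘(ℝ, ℝ).prod (𝓡 2)) 𝓘(ℝ, R7)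
        (fun q : ℝ × P => Ψ q.1 q.2) q).toLinearMap ≠ 0 then rayOfNeZero ℝ _ hη
    else (Module.finBasisOfFinrankEq ℝ (ℝ × EuclideanSpace ℝ (Fin 2)) hE).orientation
  have ho : ∀ q hη, o q = rayOfNeZero ℝ _ hη := fun q hη => dif_pos hη
  refine ⟨⟨h.analytic, fun q hq => (key q hq).1⟩, o, ?_, fun q hq => ?_⟩
  · exact isOrientationOn_of_phi hE (isOpen_Ioo.prod isOpen_univ) h.analytic
      (fun q hq => (key q hq).2.1) fun q hq => ho q _
  · obtain ⟨hinj, hη, hassoc⟩ := key q hq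
    refine ⟨hinj, ?_⟩
    rw [ho q hη]
    exact hassoc hinj

/-- A solution which is injective at time zero and has nowhere vanishing velocity is injective for
small times. -/
theorem IsEvolutionOn.exists_injOn [CompactSpace P] (hε : 0 < ε)
    (h : IsEvolutionOn χ ψ ε univ Ψ)
    (hne : ∀ q ∈ Ioo (-ε) ε ×ˢ (univ : Set P), deriv (fun s => Ψ s q.2) q.1 ≠ 0)
    (hψ : Function.Injective ψ) :
    ∃ T ∈ 𝓝 (0 : ℝ), InjOn (fun q : ℝ × P => Ψ q.1 q.2) (T ×ˢ univ) := by
  have h0 : (0 : ℝ) ∈ Ioo (-ε) ε := ⟨neg_lt_zero.2 hε, hε⟩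
  have hopen : IsOpen (Ioo (-ε) ε ×ˢ (univ : Set P)) := isOpen_Ioo.prod isOpen_univ
  have hmem : ∀ q ∈ ({0} : Set ℝ) ×ˢ (univ : Set P), q ∈ Ioo (-ε) ε ×ˢ (univ : Set P) :=
    fun q hq => ⟨by rw [show q.1 = 0 from hq.1]; exact h0, trivial⟩
  -- Injectivity on the compact set {0} × P and local injectivity at its points give injectivity on
  -- a neighbourhood O, which contains a slab by the tube lemma.
  obtain ⟨O, hO, hsub, hinj⟩ := Set.InjOn.exists_isOpen_superset
    (f := fun q : ℝ × P => Ψ q.1 q.2) (s := {0} ×ˢ univ) (by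
      rintro ⟨s, x⟩ ⟨hs, -⟩ ⟨t, y⟩ ⟨ht, -⟩ hxy
      obtain rfl : s = 0 := hs
      obtain rfl : t = 0 := ht
      have : ψ x = ψ y := by
        rw [← h.initial x trivial, ← h.initial y trivial]
        exact hxy
      rw [hψ this])
    (isCompact_singleton.prod isCompact_univ)
    (fun q hq => (h.mdifferentiableAt_uncurry (hmem q hq)).continuousAt)
    (fun q hq => exists_injOn_of_injective_mfderiv (I := 𝓘(ℝ, ℝ).prod (𝓡 2)) hopen h.analytic
      (hmem q hq) ((h.isAssociativeImmersionOn hne).1.2 q (hmem q hq)))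
  have hev := isCompact_univ.eventually_forall_of_forall_eventually
    (P := fun (t : ℝ) (p : P) => (t, p) ∈ O) (x₀ := 0) fun p _ =>
      hO.mem_nhds (hsub ⟨rfl, trivial⟩)
  exact ⟨_, hev, hinj.mono fun q hq => hq.1 q.2 trivial⟩

end AssociativeSweep

/-! ### The main theorem: choice of ε -/

theorem theorem4p3 {P : Type*} [TopologicalSpace P] [T2Space P] [CompactSpace P]
    [ChartedSpace (EuclideanSpace ℝ (Fin 2)) P] [IsManifold (𝓡 2) ω P]
    (χ : ∀ p : P, ⋀[ℝ]^2 (TangentSpace (𝓡 2) p))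
    (hχ : IsAnalyticBivector (𝓡 2) χ) (hχ_ne : ∀ p, χ p ≠ 0)
    (ψ : P → R7) (hψ : IsAnalyticImmersionOn (𝓡 2) ψ univ) :
    ∃ ε : ℝ, 0 < ε ∧ ∃ Ψ : ℝ → P → R7,
      IsEvolution (𝓡 2) χ ψ ε Ψ ∧
      (∀ Ψ' : ℝ → P → R7, IsEvolution (𝓡 2) χ ψ ε Ψ' → ∀ t ∈ Ioo (-ε) ε, Ψ' t = Ψ t) ∧
      IsAssociativeImmersionOn (𝓘(ℝ, ℝ).prod (𝓡 2)) (fun q : ℝ × P => Ψ q.1 q.2)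
        (Ioo (-ε) ε ×ˢ univ) ∧
      (IsEmbedding ψ →
        IsEmbedding ((Ioo (-ε) ε ×ˢ (univ : Set P)).domRestrict
          (fun q : ℝ × P => Ψ q.1 q.2))) := by
  obtain ⟨ε₀, hε₀, Ψ, hΨ⟩ := exists_isEvolution hχ hψ.1
  have h0 : (0 : ℝ) ∈ Ioo (-ε₀) ε₀ := ⟨neg_lt_zero.2 hε₀, hε₀⟩
  have hne : ∀ᶠ t in 𝓝 (0 : ℝ), ∀ p ∈ (univ : Set P), deriv (fun s => Ψ s p) t ≠ 0 := by
    refine isCompact_univ.eventually_forall_of_forall_eventually fun p _ =>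
      hΨ.eventually_deriv_ne_zero ⟨h0, trivial⟩ ?_
    have h1 := (hΨ.evolution 0 h0 p trivial).deriv
    have h2 : Ψ 0 = ψ := funext fun p => hΨ.initial p trivial
    rw [h2] at h1
    exact h1.trans_ne (contractPhi_map_ne_zero (hχ_ne p) (hψ.2 p trivial))
  obtain ⟨ε₁, hε₁, hsub⟩ := Metric.mem_nhds_iff.1 (Filter.inter_mem (isOpen_Ioo.mem_nhds h0) hne)
  rw [Real.ball_eq_Ioo, zero_sub, zero_add] at hsub
  have hev₁ : IsEvolutionOn χ ψ ε₁ univ Ψ := by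
    refine hΨ.mono ?_ Subset.rfl
    by_contra! hlt
    exact lt_irrefl _ (hsub ⟨by linarith, hlt⟩).1.2
  have hne₁ : ∀ q ∈ Ioo (-ε₁) ε₁ ×ˢ (univ : Set P), deriv (fun s => Ψ s q.2) q.1 ≠ 0 :=
    fun q hq => (hsub hq.1).2 q.2 trivial
  -- One ε must serve all conclusions, so T is fixed beforehand; without an embedding it imposes
  -- nothing.
  obtain ⟨T, hT, hinj⟩ : ∃ T ∈ 𝓝 (0 : ℝ), IsEmbedding ψ →
      InjOn (fun q : ℝ × P => Ψ q.1 q.2) (T ×ˢ univ) := by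
    by_cases hemb : IsEmbedding ψ
    · obtain ⟨T, hT, hinj⟩ := hev₁.exists_injOn hε₁ hne₁ hemb.injective
      exact ⟨T, hT, fun _ => hinj⟩
    · exact ⟨univ, Filter.univ_mem, fun h => absurd h hemb⟩
  -- The closed interval [-ε, ε] must lie in T and in the domain of the solution, since the
  -- embedding argument uses the compact slab.
  obtain ⟨ε, hε, hball⟩ := Metric.nhds_basis_closedBall.mem_iff.1
    (Filter.inter_mem (isOpen_Ioo.mem_nhds (⟨neg_lt_zero.2 hε₁, hε₁⟩ : (0 : ℝ) ∈ Ioo (-ε₁) ε₁)) hT)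
  rw [Real.closedBall_eq_Icc, zero_sub, zero_add] at hball
  have hε' : ε ≤ ε₁ := (hball ⟨by linarith, le_rfl⟩).1.2.le
  have hev : IsEvolutionOn χ ψ ε univ Ψ := hev₁.mono hε' Subset.rfl
  refine ⟨ε, hε, Ψ, isEvolutionOn_univ_iff.1 hev, fun Ψ' hΨ' t ht => funext fun p =>
    (isEvolutionOn_univ_iff.2 hΨ').unique hχ isOpen_univ hev t ht p trivial,
    hev.isAssociativeImmersionOn fun q hq => hne₁ q ⟨(hball (Ioo_subset_Icc_self hq.1)).1, trivial⟩,
    fun hemb => isEmbedding_domRestrict_Ioo_prod ?_ ((hinj hemb).mono ?_)⟩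
  · exact hev₁.analytic.continuousOn.mono (prod_mono (fun t ht => (hball ht).1) Subset.rfl)
  · exact prod_mono (fun t ht => (hball ht).2) Subset.rfl
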